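/- There exist absolute constants $c_1,c_2>0$ such that the following holds for all integers $n\ge 1$, $s\ge 1$ and all $\mathbf t=(t_1,\dots,t_s)\in\mathbb R^s$. Notation. A convex body in $\mathbb R^n$ is a compact convex set with non-empty interior; it is centrally symmetric if $-K=K$. For centrally symmetric $K$, $\|x\|_K=\inf\{r>0: x\in rK\}$, $X_K=(\mathbb R^n,\|\cdot\|_K)$, and $M(K)=\int_{S^{n-1}}\|\xi\|_K\,d\sigma(\xi)$ with $\sigma$ the rotation invariant probability measure on $S^{n-1}$. For convex bodies $C,K$ put $$\|\mathbf t\|_{C^s,K}=\frac{1}{\mathrm{vol}_n(C)^s}\int_C\cdots\int_C\Big\|\sum_{j=1}^s t_jx_j\Big\|_K\,dx_1\cdots dx_s .$$ The cotype-2 constant is $C_2(X_K)=\sup_k C_{2,k}(X_K)$, where $C_{2,k}(X_K)$ is the best constant $A>0$ such that $\big(\mathbb E_\epsilon\|\sum_{i=1}^k\epsilon_ix_i\|_K^2\big)^{1/2}\ge \frac1A\big(\sum_{i=1}^k\|x_i\|_K^2\big)^{1/2}$ for all $x_1,\dots,x_k\in\mathbb R^n$, the $\epsilon_i=\pm1$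 being independent uniform signs. A convex body $C$ is isotropic if $\mathrm{vol}_n(C)=1$, its barycenter is $0$ and there is $L>0$ with $\int_C\langle x,\xi\rangle^2dx=L^2$ for all $\xi\in S^{n-1}$. The isotropic constant of a convex body $C$ is $L_C=\mathrm{vol}_n(C)^{-1/n}\,(\det\mathrm{Cov}(C))^{1/(2n)}$, where $\mathrm{Cov}(C)$ is the covariance matrix of the uniform probability measure on $C$; for isotropic $C$ it equals the number $L$ above. An isotropic image of $K$ is an isotropic body of the form $T(K)$ with $T$ an invertible linear map. (i) If $C$ is an isotropic centrally symmetric convex body and $K$ is a centrally symmetric convex body in $\mathbb R^n$, then $$\frac{c_1}{C_2(X_K)}\,\mathrm{vol}_n(K)^{-1/n}\,\|\mathbf t\|_2\le\|\mathbf t\|_{C^s,K}\le c_2\,L_C\,C_2(X_K)\,\sqrt n\,M(K)\,\|\mathbf t\|_2 .$$ (ii) If $K$ is any centrally symmetric convex body in $\mathbb R^n$ and $K_{\rm iso}$ is an isotropic image of $K$, then $$\frac{c_1}{C_2(X_K)}\,\|\mathbf t\|_2\le\|\mathbf t\|_{K^s,K}\le c_2\,L_K\,C_2(X_K)\,\sqrt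 n\,M(K_{\rm iso})\,\|\mathbf t\|_2 .$$ -/

import Mathlib

open MeasureTheory

/-- A convex body in `ℝⁿ`: a compact convex set with non-empty interior. -/
structure IsConvexBody {n : ℕ} (C : Set (EuclideanSpace ℝ (Fin n))) : Prop where
  isCompact : IsCompact C
  convex : Convex ℝ C
  interior_nonempty : (interior C).Nonempty

/-- A centrally symmetric convex body: a convex body `C` with `-C = C`. -/
structure IsSymmConvexBody {n : ℕ} (C : Set (EuclideanSpace ℝ (Fin n))) : Prop
    extends IsConvexBody C where
  neg_mem : ∀ x ∈ C, -x ∈ C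

/-- `C` is isotropic: a convex body of volume one, with barycenter at the origin, such that
`∫_C ⟨x, ξ⟩² dx` is the same positive constant `L²` for all unit vectors `ξ`. -/
structure IsIsotropic {n : ℕ} (C : Set (EuclideanSpace ℝ (Fin n))) : Prop
    extends IsConvexBody C where
  volume_eq_one : volume C = 1
  barycenter_eq_zero : ∫ x in C, x = 0
  inertia : ∃ L : ℝ, 0 < L ∧
    ∀ ξ : EuclideanSpace ℝ (Fin n), ‖ξ‖ = 1 → ∫ x in C, (inner ℝ x ξ) ^ 2 = L ^ 2

/-- `K'` is an isotropic image of `K`: it is isotropic and `K' = T(K)` for an invertible linear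
map `T`. -/
def IsIsotropicImage {n : ℕ} (K K' : Set (EuclideanSpace ℝ (Fin n))) : Prop :=
  IsIsotropic K' ∧
    ∃ T : EuclideanSpace ℝ (Fin n) ≃ₗ[ℝ] EuclideanSpace ℝ (Fin n), K' = T '' K

/-- The covariance matrix of the uniform probability measure on `C`. -/
noncomputable def covMatrix {n : ℕ} (C : Set (EuclideanSpace ℝ (Fin n))) :
    Matrix (Fin n) (Fin n) ℝ :=
  Matrix.of fun i j =>
    (∫ x in C, x i * x j) / volume.real C
      - (∫ x in C, x i) / volume.real C * ((∫ x in C, x j) / volume.real C)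

/-- The isotropic constant `L_C` of a convex body, that is, the number
`(sup f / ∫ f)^(1/n) * (det Cov)^(1/(2n))` for the density `f = 1_C`. If `C` is isotropic, it is
the constant `L` of the isotropic condition (`isotropicConst_eq` below). -/
noncomputable def isotropicConst {n : ℕ} (C : Set (EuclideanSpace ℝ (Fin n))) : ℝ :=
  (1 / volume.real C) ^ (1 / (n : ℝ)) * (covMatrix C).det ^ (1 / (2 * (n : ℝ)))

/-- `M(K)`: the average of the gauge `‖ξ‖_K` over the unit sphere with respect to the normalized
rotation invariant measure. -/
noncomputable def sphereMean {n : ℕ} (K : Set (EuclideanSpace ℝ (Fin n))) : ℝ :=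
  ⨍ ξ : Metric.sphere (0 : EuclideanSpace ℝ (Fin n)) 1,
    gauge K (ξ : EuclideanSpace ℝ (Fin n)) ∂((volume : Measure (EuclideanSpace ℝ (Fin n))).toSphere)

/-- `‖t‖_{𝒞,K}` for a tuple `𝒞 = (C₁, …, C_s)`: the average of `‖∑ⱼ tⱼ xⱼ‖_K` over
`C₁ × ⋯ × C_s`. -/
noncomputable def multiNorm {n s : ℕ} (C : Fin s → Set (EuclideanSpace ℝ (Fin n)))
    (K : Set (EuclideanSpace ℝ (Fin n))) (t : EuclideanSpace ℝ (Fin s)) : ℝ :=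
  (1 / ∏ j, volume.real (C j)) *
    ∫ x : Fin s → EuclideanSpace ℝ (Fin n) in Set.univ.pi C, gauge K (∑ j, t j • x j)

/-- `𝔼_ε ‖∑ᵢ εᵢ xᵢ‖_K²`, the average over all choices of signs `ε ∈ {-1, 1}ᵏ`. -/
noncomputable def rademacherSq {n : ℕ} (K : Set (EuclideanSpace ℝ (Fin n))) {k : ℕ}
    (x : Fin k → EuclideanSpace ℝ (Fin n)) : ℝ :=
  (1 / 2 ^ k) * ∑ ε : Fin k → ℤˣ, gauge K (∑ i, ((ε i : ℤ) : ℝ) • x i) ^ 2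

/-- The numbers `C > 0` such that the cotype-2 inequality with constant `C` holds in `X_K` for
all `k`-tuples of vectors. -/
def cotypeTwoSet {n : ℕ} (K : Set (EuclideanSpace ℝ (Fin n))) (k : ℕ) : Set ℝ :=
  {C : ℝ | 0 < C ∧ ∀ x : Fin k → EuclideanSpace ℝ (Fin n),
    1 / C * Real.sqrt (∑ i, gauge K (x i) ^ 2) ≤ Real.sqrt (rademacherSq K x)}

/-- `C_{2,k}(X_K)`, the best constant in the cotype-2 inequality for `k` vectors. -/
noncomputable def cotypeTwoConstAux {n : ℕ} (K : Set (EuclideanSpace ℝ (Fin n))) (k : ℕ) : ℝ :=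
  sInf (cotypeTwoSet K k)

/-- `C_2(X_K) = sup_k C_{2,k}(X_K)`, the cotype-2 constant of the normed space with unit ball
`K`. The supremum is finite (`bddAbove_cotypeTwoConstAux` below). -/
noncomputable def cotypeTwoConst {n : ℕ} (K : Set (EuclideanSpace ℝ (Fin n))) : ℝ :=
  ⨆ k : ℕ, cotypeTwoConstAux K k

theorem isotropicConst_eq {n : ℕ} (hn : 1 ≤ n) {C : Set (EuclideanSpace ℝ (Fin n))}
    (hC : IsIsotropic C) {L : ℝ} (hL : 0 < L)
    (h : ∀ ξ : EuclideanSpace ℝ (Fin n), ‖ξ‖ = 1 → ∫ x in C, (inner ℝ x ξ) ^ 2 = L ^ 2) :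
    isotropicConst C = L := by
  have hv : volume.real C = 1 := by simp [Measure.real, hC.volume_eq_one]
  have hint : ∀ f : EuclideanSpace ℝ (Fin n) → ℝ, Continuous f → IntegrableOn f C := fun f hf =>
    hf.continuousOn.integrableOn_compact hC.isCompact
  have h0 : ∀ i, ∫ x in C, x i = 0 := by
    intro i
    have h1 := (EuclideanSpace.proj i : EuclideanSpace ℝ (Fin n) →L[ℝ] ℝ).integral_comp_comm
      (μ := volume.restrict C) (φ := fun x => x)
      (continuous_id.continuousOn.integrableOn_compact hC.isCompact)
    rw [hC.barycenter_eq_zero] at h1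
    simpa using h1
  have hd : ∀ i, ∫ x in C, x i * x i = L ^ 2 := by
    intro i
    have h1 := h (EuclideanSpace.single i 1) (by simp)
    rw [← h1]
    congr 1
    ext x
    simp [EuclideanSpace.inner_single_right, sq]
  have ho : ∀ i j, i ≠ j → ∫ x in C, x i * x j = 0 := by
    intro i j hij
    have hnorm : ‖(EuclideanSpace.single i (1 : ℝ) + EuclideanSpace.single j 1)‖ ^ 2 = 2 := by
      rw [@norm_add_sq_real]
      simp [EuclideanSpace.inner_single_right, hij.symm]
      norm_num
    set v := EuclideanSpace.single i (1 : ℝ) + EuclideanSpace.single j 1 with hvdef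
    have hvpos : 0 < ‖v‖ := by
      rcases (norm_nonneg v).eq_or_lt with h2 | h2
      · rw [← h2] at hnorm; norm_num at hnorm
      · exact h2
    have h1 := h (‖v‖⁻¹ • v) (by rw [norm_smul, norm_inv, norm_norm, inv_mul_cancel₀ hvpos.ne'])
    have h2 : ∀ x : EuclideanSpace ℝ (Fin n), (inner ℝ x (‖v‖⁻¹ • v)) ^ 2
        = (1 / 2) * (x i * x i + x j * x j) + x i * x j := by
      intro x
      rw [inner_smul_right, mul_pow, inv_pow, hnorm, hvdef, inner_add_right]
      simp [EuclideanSpace.inner_single_right]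
      ring
    simp_rw [h2] at h1
    rw [integral_add (hint _ (by fun_prop)) (hint _ (by fun_prop)), integral_const_mul,
      integral_add (hint _ (by fun_prop)) (hint _ (by fun_prop)), hd, hd] at h1
    linarith
  have hcov : covMatrix C = (L ^ 2) • (1 : Matrix (Fin n) (Fin n) ℝ) := by
    ext i j
    by_cases hij : i = j
    · subst hij
      simp [covMatrix, hv, h0, hd]
    · simp [covMatrix, hv, h0, ho i j hij, hij]
  have hn0 : (n : ℝ) ≠ 0 := by positivity
  rw [isotropicConst, hcov, hv, Matrix.det_smul]
  simp only [div_one, Real.one_rpow, one_mul, Matrix.det_one, mul_one, Fintype.card_fin]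
  rw [← pow_mul, ← Real.rpow_natCast, ← Real.rpow_mul hL.le]
  push_cast
  rw [mul_one_div_cancel (by positivity), Real.rpow_one]

theorem sum_signs_norm_sq {n : ℕ} : ∀ {k : ℕ} (y : EuclideanSpace ℝ (Fin n))
    (x : Fin k → EuclideanSpace ℝ (Fin n)),
    ∑ ε : Fin k → ℤˣ, ‖y + ∑ i, ((ε i : ℤ) : ℝ) • x i‖ ^ 2
      = 2 ^ k * (‖y‖ ^ 2 + ∑ i, ‖x i‖ ^ 2) := by
  intro k
  induction k with
  | zero => intro y x; simp
  | succ k ih =>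
    intro y x
    rw [← (Fin.consEquiv fun _ => ℤˣ).sum_comp, Fintype.sum_prod_type]
    have hu : (Finset.univ : Finset ℤˣ) = {1, -1} := rfl
    rw [hu, Finset.sum_pair (by decide)]
    simp only [Fin.consEquiv, Equiv.coe_fn_mk, Fin.sum_univ_succ, Fin.cons_zero, Fin.cons_succ,
      ← add_assoc]
    rw [ih, ih]
    have hp := parallelogram_law_with_norm ℝ y (x 0)
    simp only [Units.val_one, Int.cast_one, one_smul, Units.val_neg, Int.cast_neg, neg_smul,
      ← sub_eq_add_neg]
    rw [pow_succ]
    linear_combination (2 : ℝ) ^ k * hp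

theorem bddAbove_cotypeTwoConstAux {n : ℕ} {K : Set (EuclideanSpace ℝ (Fin n))}
    (hK : IsSymmConvexBody K) : BddAbove (Set.range (cotypeTwoConstAux K)) := by
  obtain ⟨a, ha⟩ := hK.interior_nonempty
  have hKn : -K = K := by
    ext x
    exact ⟨fun hx => by simpa using hK.neg_mem _ hx, fun hx => hK.neg_mem _ hx⟩
  have h0 : (0 : EuclideanSpace ℝ (Fin n)) ∈ interior K := by
    have hna : -a ∈ interior K := by
      have h1 := (Homeomorph.neg (EuclideanSpace ℝ (Fin n))).preimage_interior K
      have h2 : (Homeomorph.neg (EuclideanSpace ℝ (Fin n))) ⁻¹' K = K := hKn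
      rw [h2] at h1
      rw [← h1] at ha
      exact ha
    have := hK.convex.interior ha hna (by norm_num : (0 : ℝ) ≤ 1 / 2)
      (by norm_num : (0 : ℝ) ≤ 1 / 2) (by norm_num)
    simpa using this
  obtain ⟨r, hr, hrK⟩ := Metric.isOpen_iff.1 isOpen_interior 0 h0
  have hrK' : Metric.ball (0 : EuclideanSpace ℝ (Fin n)) r ⊆ K := hrK.trans interior_subset
  obtain ⟨R, hR, hKR⟩ := hK.isCompact.isBounded.subset_closedBall_lt 0 0
  have habs : Absorbent ℝ K := absorbent_nhds_zero (mem_interior_iff_mem_nhds.1 h0)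
  refine ⟨R / r, ?_⟩
  rintro _ ⟨k, rfl⟩
  refine csInf_le ⟨0, fun c hc => hc.1.le⟩ ⟨by positivity, fun x => ?_⟩
  have h1 : ∑ i, gauge K (x i) ^ 2 ≤ (∑ i, ‖x i‖ ^ 2) / r ^ 2 := by
    rw [Finset.sum_div]
    refine Finset.sum_le_sum fun i _ => ?_
    rw [← div_pow]
    refine pow_le_pow_left₀ (gauge_nonneg _) ?_ 2
    rw [le_div_iff₀ hr, mul_comm]
    exact mul_gauge_le_norm hrK'
  have h2 : (∑ i, ‖x i‖ ^ 2) / R ^ 2 ≤ rademacherSq K x := by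
    have h3 := sum_signs_norm_sq 0 x
    simp only [zero_add, norm_zero, ne_eq, OfNat.ofNat_ne_zero, not_false_eq_true, zero_pow] at h3
    have h4 : (∑ i, ‖x i‖ ^ 2) = (1 / 2 ^ k) *
        ∑ ε : Fin k → ℤˣ, ‖∑ i, ((ε i : ℤ) : ℝ) • x i‖ ^ 2 := by
      rw [h3]; field_simp
    rw [h4, rademacherSq, mul_div_assoc, Finset.sum_div]
    gcongr with ε
    rw [← div_pow]
    exact pow_le_pow_left₀ (by positivity) (le_gauge_of_subset_closedBall habs hR.le hKR) 2
  have h5 : 1 / (R / r) = Real.sqrt ((r / R) ^ 2) := by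
    rw [Real.sqrt_sq (by positivity)]; field_simp
  rw [h5, ← Real.sqrt_mul (by positivity)]
  refine Real.sqrt_le_sqrt (le_trans ?_ h2)
  calc (r / R) ^ 2 * ∑ i, gauge K (x i) ^ 2
      ≤ (r / R) ^ 2 * ((∑ i, ‖x i‖ ^ 2) / r ^ 2) := by gcongr
    _ = (∑ i, ‖x i‖ ^ 2) / R ^ 2 := by field_simp

/-! Both bounds come from one cotype inequality for independent symmetric vectors. If `y i` are
independent copies of a symmetric variable and the norm of `ℓ i (y i)` is `a i * φ (y i)`, random
signs may be inserted without changing the law. Cotype 2, with the second moment over signs replaced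
by the first through the Khintchine–Kahane inequality (constant √2), then gives `‖a‖₂ 𝔼φ ≤ √2
C₂(X_K) 𝔼‖∑ ℓ i (y i)‖_K`; this is `sqrt_sum_sq_mul_integral_le`.

Lower bound: take `y` uniform on the symmetric body `C` and `ℓ j x = t j • x`. It remains to bound
the mean of `‖x‖_K` over `C` from below, which is a volume comparison with a dilate of `K`
(`gauge_average_ge`).

Upper bound: `X = ∑ t j • x j` has second moments `𝔼⟨X, ξ⟩² = (L‖t‖)²‖ξ‖²`. By Carathéodory there
are finitely many vectors `v i` with `∑ ‖v i‖_K² = 𝔼‖X‖_K²` and `∑ ⟨v i, ξ⟩² = (L‖t‖)²‖ξ‖²`. For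
independent standard Gaussians `g i`, the vector `∑ g i • v i` is distributed as `L‖t‖` times a
standard Gaussian vector `G`. The cotype inequality bounds `𝔼‖X‖_K ≤ (𝔼‖X‖_K²)^(1/2)` by a multiple
of `C₂(X_K) L‖t‖ 𝔼‖G‖_K`, and polar coordinates give `𝔼‖G‖_K ≤ √n M(K)`.

Part (ii) follows because the average, the cotype constant and the isotropic constant are unchanged
when `K` is replaced by a linear image. -/

open scoped Pointwise
open ProbabilityTheory

/-! ### Spectral gap on the discrete cube -/

/-- The Dirichlet energy of a function on the discrete cube. -/
noncomputable def signEnergy {k : ℕ} (f : (Fin k → ℤˣ) → ℝ) : ℝ :=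
  1 / 4 * ∑ ε, ∑ i, (f ε - f (Function.update ε i (-ε i))) ^ 2

theorem sum_signs_succ {M : Type*} [AddCommMonoid M] {k : ℕ} (f : (Fin (k + 1) → ℤˣ) → M) :
    ∑ ε, f ε = ∑ ε : Fin k → ℤˣ, f (Fin.cons 1 ε) + ∑ ε : Fin k → ℤˣ, f (Fin.cons (-1) ε) := by
  rw [← (Fin.consEquiv fun _ => ℤˣ).sum_comp, Fintype.sum_prod_type]
  have hu : (Finset.univ : Finset ℤˣ) = {1, -1} := rfl
  rw [hu, Finset.sum_pair (by decide)]
  rfl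

/-- Splitting `f` into its even part `g` and odd part `h` in the first coordinate makes the energy
additive. The last sum is the contribution of flipping that coordinate, to which only `h`
contributes. -/
theorem signEnergy_succ {k : ℕ} (f : (Fin (k + 1) → ℤˣ) → ℝ) :
    signEnergy f = 2 * signEnergy (fun ε => (f (Fin.cons 1 ε) + f (Fin.cons (-1) ε)) / 2)
      + 2 * signEnergy (fun ε => (f (Fin.cons 1 ε) - f (Fin.cons (-1) ε)) / 2)
      + 2 * ∑ ε : Fin k → ℤˣ, ((f (Fin.cons 1 ε) - f (Fin.cons (-1) ε)) / 2) ^ 2 := by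
  simp only [signEnergy, sum_signs_succ, Fin.sum_univ_succ, Fin.cons_zero, Fin.cons_succ,
    Fin.update_cons_zero, ← Fin.cons_update, neg_neg, Finset.mul_sum, ← Finset.sum_add_distrib,
    mul_add]
  refine Finset.sum_congr rfl fun ε _ => ?_
  rw [add_add_add_comm, ← Finset.sum_add_distrib, add_comm]
  congr 1
  · refine Finset.sum_congr rfl fun i _ => ?_
    ring
  · ring

theorem Fin.cons_neg_signs {k : ℕ} (a : ℤˣ) (ε : Fin k → ℤˣ) :
    (Fin.cons a (-ε) : Fin (k + 1) → ℤˣ) = -Fin.cons (-a) ε := by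
  ext i
  refine Fin.cases ?_ (fun j => ?_) i <;> simp

/-- In Walsh terms, a character of degree `d` has energy `d` times its square sum, and an odd
function has only degrees at least 1. The induction avoids Walsh expansions: for odd `f` the part
`g` is again odd, and `h` is paid for by the last term of `signEnergy_succ`. -/
theorem sum_sq_le_signEnergy_of_odd : ∀ {k : ℕ} (f : (Fin k → ℤˣ) → ℝ),
    (∀ ε, f (-ε) = -f ε) → ∑ ε, f ε ^ 2 ≤ signEnergy f
  | 0, f, hf => by
    have h : ∀ ε, f ε = 0 := fun ε => by
      have := hf ε
      rw [Subsingleton.elim (-ε) ε] at this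
      linarith
    simp [signEnergy, h]
  | k + 1, f, hf => by
    have h1 : ∀ ε, f (Fin.cons 1 (-ε)) = -f (Fin.cons (-1) ε) := fun ε => by
      rw [Fin.cons_neg_signs, hf]
    have h2 : ∀ ε, f (Fin.cons (-1) (-ε)) = -f (Fin.cons 1 ε) := fun ε => by
      rw [Fin.cons_neg_signs, hf, neg_neg]
    have hg := sum_sq_le_signEnergy_of_odd
      (fun ε => (f (Fin.cons 1 ε) + f (Fin.cons (-1) ε)) / 2) fun ε => by
        simp only [h1, h2]; ring
    have hh : 0 ≤ signEnergy (fun ε => (f (Fin.cons 1 ε) - f (Fin.cons (-1) ε)) / 2) := by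
      unfold signEnergy; positivity
    have hs : ∑ ε, f ε ^ 2
        = 2 * ∑ ε : Fin k → ℤˣ, ((f (Fin.cons 1 ε) + f (Fin.cons (-1) ε)) / 2) ^ 2
          + 2 * ∑ ε : Fin k → ℤˣ, ((f (Fin.cons 1 ε) - f (Fin.cons (-1) ε)) / 2) ^ 2 := by
      simp only [sum_signs_succ, Finset.mul_sum, ← Finset.sum_add_distrib]
      exact Finset.sum_congr rfl fun ε _ => by ring
    rw [signEnergy_succ, hs]
    linarith

/-- An even function has no Walsh component of degree 1, so the gap above the constants doubles to
2. In the induction `g` is even and `h` is odd; the odd case supplies the second copy of `∑ h²`. -/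
theorem two_mul_variance_le_signEnergy_of_even : ∀ {k : ℕ} (f : (Fin k → ℤˣ) → ℝ),
    (∀ ε, f (-ε) = f ε) → 2 * (∑ ε, f ε ^ 2 - (∑ ε, f ε) ^ 2 / 2 ^ k) ≤ signEnergy f
  | 0, f, hf => by simp [signEnergy]
  | k + 1, f, hf => by
    have h1 : ∀ ε, f (Fin.cons 1 (-ε)) = f (Fin.cons (-1) ε) := fun ε => by
      rw [Fin.cons_neg_signs, hf]
    have h2 : ∀ ε, f (Fin.cons (-1) (-ε)) = f (Fin.cons 1 ε) := fun ε => by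
      rw [Fin.cons_neg_signs, hf, neg_neg]
    have hg := two_mul_variance_le_signEnergy_of_even
      (fun ε => (f (Fin.cons 1 ε) + f (Fin.cons (-1) ε)) / 2) fun ε => by
        simp only [h1, h2]; ring
    have hh := sum_sq_le_signEnergy_of_odd
      (fun ε => (f (Fin.cons 1 ε) - f (Fin.cons (-1) ε)) / 2) fun ε => by
        simp only [h1, h2]; ring
    have hs : ∑ ε, f ε ^ 2
        = 2 * ∑ ε : Fin k → ℤˣ, ((f (Fin.cons 1 ε) + f (Fin.cons (-1) ε)) / 2) ^ 2
          + 2 * ∑ ε : Fin k → ℤˣ, ((f (Fin.cons 1 ε) - f (Fin.cons (-1) ε)) / 2) ^ 2 := by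
      simp only [sum_signs_succ, Finset.mul_sum, ← Finset.sum_add_distrib]
      exact Finset.sum_congr rfl fun ε _ => by ring
    have hm : ∑ ε, f ε = 2 * ∑ ε : Fin k → ℤˣ, (f (Fin.cons 1 ε) + f (Fin.cons (-1) ε)) / 2 := by
      simp only [sum_signs_succ, Finset.mul_sum, ← Finset.sum_add_distrib]
      exact Finset.sum_congr rfl fun ε _ => by ring
    have hd : ∀ a : ℝ, (2 * a) ^ 2 / 2 ^ (k + 1) = 2 * (a ^ 2 / 2 ^ k) := fun a => by
      rw [pow_succ]; field_simp; ring
    rw [signEnergy_succ, hs, hm, hd]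
    linarith

/-- Summation by parts: flipping a coordinate is an involution, so `f²` and its flipped version have
equal sums. -/
theorem signEnergy_eq {k : ℕ} (f : (Fin k → ℤˣ) → ℝ) :
    signEnergy f = 1 / 2 * ∑ ε, f ε * ∑ i, (f ε - f (Function.update ε i (-ε i))) := by
  have h : ∀ i, ∑ ε, (f ε - f (Function.update ε i (-ε i))) ^ 2
      = 2 * ∑ ε, f ε * (f ε - f (Function.update ε i (-ε i))) := by
    intro i
    have hinv : Function.Involutive fun ε : Fin k → ℤˣ => Function.update ε i (-ε i) := by
      intro ε; simp
    have h1 : ∑ ε : Fin k → ℤˣ, f (Function.update ε i (-ε i)) ^ 2 = ∑ ε, f ε ^ 2 :=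
      Equiv.sum_comp (hinv.toPerm _) fun ε => f ε ^ 2
    have h2 : ∑ ε : Fin k → ℤˣ, (f ε - f (Function.update ε i (-ε i))) ^ 2
        = 2 * ∑ ε, f ε * (f ε - f (Function.update ε i (-ε i)))
          + (∑ ε : Fin k → ℤˣ, f (Function.update ε i (-ε i)) ^ 2 - ∑ ε, f ε ^ 2) := by
      rw [Finset.mul_sum, ← Finset.sum_sub_distrib, ← Finset.sum_add_distrib]
      exact Finset.sum_congr rfl fun ε _ => by ring
    rw [h2, h1, sub_self, add_zero]
  rw [signEnergy, Finset.sum_comm]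
  simp only [h, Finset.mul_sum Finset.univ (fun i : Fin k => f _ - f (Function.update _ i _)) (f _)]
 
  rw [← Finset.mul_sum, Finset.sum_comm, ← mul_assoc]
  norm_num

/-! ### The Khintchine–Kahane inequality -/

section Kahane

variable {E : Type*} [AddCommGroup E] [Module ℝ E]

theorem Seminorm.sum_le {ι : Type*} (p : Seminorm ℝ E) (s : Finset ι) (x : ι → E) :
    p (∑ i ∈ s, x i) ≤ ∑ i ∈ s, p (x i) :=
  Finset.le_sum_of_subadditive p (map_zero p).le (map_add_le_add p) s x

theorem sum_update_signs {k : ℕ} (x : Fin k → E) (ε : Fin k → ℤˣ) (i : Fin k) :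
    ∑ j, ((Function.update ε i (-ε i) j : ℤ) : ℝ) • x j
      = ∑ j, ((ε j : ℤ) : ℝ) • x j - (2 : ℝ) • (((ε i : ℤ) : ℝ) • x i) := by
  rw [eq_sub_iff_add_eq, ← eq_sub_iff_add_eq', ← Finset.sum_sub_distrib,
    Finset.sum_eq_single i]
  · simp [two_smul]
  · intro j _ hj
    simp [Function.update_of_ne hj]
  · simp

/-- The Khintchine–Kahane inequality with the optimal constant. -/
theorem Seminorm.sum_signs_sq_le (p : Seminorm ℝ E) {k : ℕ} (x : Fin k → E) :
    ∑ ε : Fin k → ℤˣ, p (∑ i, ((ε i : ℤ) : ℝ) • x i) ^ 2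
      ≤ 2 * ((∑ ε : Fin k → ℤˣ, p (∑ i, ((ε i : ℤ) : ℝ) • x i)) ^ 2 / 2 ^ k) := by
  set f : (Fin k → ℤˣ) → ℝ := fun ε => p (∑ i, ((ε i : ℤ) : ℝ) • x i) with hf
  have heven : ∀ ε, f (-ε) = f ε := fun ε => by
    simp only [hf, Pi.neg_apply, Units.val_neg, Int.cast_neg, neg_smul, Finset.sum_neg_distrib,
      map_neg_eq_map]
  -- The `k` neighbours of `y = ∑ εⱼxⱼ` are `y - 2εᵢxᵢ`, and they add up to `(k - 2)y`; the triangle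
  -- inequality does the rest.
  have hflip : ∀ ε, ((k : ℝ) - 2) * f ε ≤ ∑ i, f (Function.update ε i (-ε i)) := by
    intro ε
    refine le_trans ?_ (p.sum_le Finset.univ _)
    simp only [sum_update_signs]
    rw [Finset.sum_sub_distrib, ← Finset.smul_sum, Finset.sum_const, Finset.card_univ,
      Fintype.card_fin, ← Nat.cast_smul_eq_nsmul ℝ, ← sub_smul, map_smul_eq_mul]
    exact mul_le_mul_of_nonneg_right (le_abs_self _) (apply_nonneg p _)
  -- By `hflip`, `∑ᵢ (f ε - f(flipᵢ ε)) ≤ 2 f ε`. Together with the gap 2 for even functions this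
  -- gives `2(∑f² - (∑f)²/2ᵏ) ≤ ∑f²`.
  have henergy : signEnergy f ≤ ∑ ε, f ε ^ 2 := by
    rw [signEnergy_eq, Finset.mul_sum]
    refine Finset.sum_le_sum fun ε _ => ?_
    have h0 : 0 ≤ f ε := apply_nonneg p _
    rw [Finset.sum_sub_distrib, Finset.sum_const, Finset.card_univ, Fintype.card_fin, nsmul_eq_mul]
    nlinarith [mul_le_mul_of_nonneg_left (hflip ε) h0]
  have := two_mul_variance_le_signEnergy_of_even f heven
  linarith

end Kahane

/-! ### The norm of a symmetric body and its cotype-2 constant -/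

namespace IsSymmConvexBody

variable {n : ℕ} {K : Set (EuclideanSpace ℝ (Fin n))}

theorem mem_nhds_zero (hK : IsSymmConvexBody K) : K ∈ nhds 0 := by
  obtain ⟨a, ha⟩ := hK.interior_nonempty
  have hKn : -K = K := by
    ext x
    exact ⟨fun hx => by simpa using hK.neg_mem _ hx, fun hx => hK.neg_mem _ hx⟩
  have hna : -a ∈ interior K := by
    have h1 := (Homeomorph.neg (EuclideanSpace ℝ (Fin n))).preimage_interior K
    have h2 : (Homeomorph.neg (EuclideanSpace ℝ (Fin n))) ⁻¹' K = K := hKn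
    rw [h2] at h1
    rw [← h1] at ha
    exact ha
  have := hK.convex.interior ha hna (by norm_num : (0 : ℝ) ≤ 1 / 2)
    (by norm_num : (0 : ℝ) ≤ 1 / 2) (by norm_num)
  exact mem_interior_iff_mem_nhds.1 (by simpa using this)

theorem absorbent (hK : IsSymmConvexBody K) : Absorbent ℝ K := absorbent_nhds_zero hK.mem_nhds_zero

theorem balanced (hK : IsSymmConvexBody K) : Balanced ℝ K :=
  (balanced_iff_neg_mem hK.convex).2 fun {x} hx => hK.neg_mem x hx

/-- The norm with unit ball `K`, as a seminorm. -/
noncomputable def seminorm (hK : IsSymmConvexBody K) : Seminorm ℝ (EuclideanSpace ℝ (Fin n)) :=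
  gaugeSeminorm hK.balanced hK.convex hK.absorbent

theorem seminorm_apply (hK : IsSymmConvexBody K) (x : EuclideanSpace ℝ (Fin n)) :
    hK.seminorm x = gauge K x := rfl

theorem continuous_seminorm (hK : IsSymmConvexBody K) : Continuous hK.seminorm :=
  continuous_gauge hK.convex hK.mem_nhds_zero

/-- Comparison with the Euclidean norm, for which the parallelogram law gives equality. Nonemptiness
matters because `sInf ∅ = 0` would make the constant meaningless. -/
theorem cotypeTwoSet_nonempty (hK : IsSymmConvexBody K) (k : ℕ) : (cotypeTwoSet K k).Nonempty := by
  obtain ⟨r, hr, hrK⟩ := Metric.mem_nhds_iff.1 hK.mem_nhds_zero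
  obtain ⟨R, hR, hKR⟩ := hK.isCompact.isBounded.subset_closedBall_lt 0 0
  refine ⟨R / r, by positivity, fun x => ?_⟩
  have h1 : ∑ i, gauge K (x i) ^ 2 ≤ (∑ i, ‖x i‖ ^ 2) / r ^ 2 := by
    rw [Finset.sum_div]
    refine Finset.sum_le_sum fun i _ => ?_
    rw [← div_pow]
    refine pow_le_pow_left₀ (gauge_nonneg _) ?_ 2
    rw [le_div_iff₀ hr, mul_comm]
    exact mul_gauge_le_norm hrK
  have h2 : (∑ i, ‖x i‖ ^ 2) / R ^ 2 ≤ rademacherSq K x := by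
    have h3 := sum_signs_norm_sq 0 x
    simp only [zero_add, norm_zero, ne_eq, OfNat.ofNat_ne_zero, not_false_eq_true, zero_pow] at h3
    have h4 : (∑ i, ‖x i‖ ^ 2) = (1 / 2 ^ k) *
        ∑ ε : Fin k → ℤˣ, ‖∑ i, ((ε i : ℤ) : ℝ) • x i‖ ^ 2 := by
      rw [h3]; field_simp
    rw [h4, rademacherSq, mul_div_assoc, Finset.sum_div]
    gcongr with ε
    rw [← div_pow]
    exact pow_le_pow_left₀ (by positivity) (le_gauge_of_subset_closedBall hK.absorbent hR.le hKR) 2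
  have h5 : 1 / (R / r) = Real.sqrt ((r / R) ^ 2) := by
    rw [Real.sqrt_sq (by positivity)]; field_simp
  rw [h5, ← Real.sqrt_mul (by positivity)]
  refine Real.sqrt_le_sqrt (le_trans ?_ h2)
  calc (r / R) ^ 2 * ∑ i, gauge K (x i) ^ 2
      ≤ (r / R) ^ 2 * ((∑ i, ‖x i‖ ^ 2) / r ^ 2) := by gcongr
    _ = (∑ i, ‖x i‖ ^ 2) / R ^ 2 := by field_simp

theorem sqrt_sum_gauge_sq_le (hK : IsSymmConvexBody K) {k : ℕ}
    (x : Fin k → EuclideanSpace ℝ (Fin n)) :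
    Real.sqrt (∑ i, gauge K (x i) ^ 2) ≤ cotypeTwoConst K * Real.sqrt (rademacherSq K x) := by
  have h1 : ∀ A ∈ cotypeTwoSet K k,
      Real.sqrt (∑ i, gauge K (x i) ^ 2) ≤ A * Real.sqrt (rademacherSq K x) := by
    rintro A ⟨hA, h⟩
    have := h x
    rwa [one_div, inv_mul_le_iff₀ hA] at this
  have h2 : Real.sqrt (∑ i, gauge K (x i) ^ 2)
      ≤ cotypeTwoConstAux K k * Real.sqrt (rademacherSq K x) := by
    -- The infimum is itself admissible. When the sign average vanishes one cannot divide by it, but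
    -- any admissible constant already forces the left side to be at most 0.
    rcases (Real.sqrt_nonneg (rademacherSq K x)).eq_or_lt with h0 | h0
    · obtain ⟨A, hA⟩ := hK.cotypeTwoSet_nonempty k
      have := h1 A hA
      rw [← h0, mul_zero] at this ⊢
      exact this
    · rw [← div_le_iff₀ h0]
      refine le_csInf (hK.cotypeTwoSet_nonempty k) fun A hA => ?_
      rw [div_le_iff₀ h0]
      exact h1 A hA
  refine h2.trans (mul_le_mul_of_nonneg_right ?_ (Real.sqrt_nonneg _))
  exact le_ciSup (bddAbove_cotypeTwoConstAux hK) k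

/-- For a single nonzero vector the sign average is the squared norm itself, so no constant below 1
is admissible. -/
theorem one_le_cotypeTwoConst (hK : IsSymmConvexBody K) (hn : 1 ≤ n) : 1 ≤ cotypeTwoConst K := by
  refine le_trans ?_ (le_ciSup (bddAbove_cotypeTwoConstAux hK) 1)
  refine le_csInf (hK.cotypeTwoSet_nonempty 1) ?_
  rintro A ⟨hA, h⟩
  set v : EuclideanSpace ℝ (Fin n) := EuclideanSpace.single ⟨0, hn⟩ 1 with hv
  have hpos : 0 < gauge K v :=
    (gauge_pos hK.absorbent
      ((NormedSpace.isVonNBounded_iff ℝ).2 hK.isCompact.isBounded)).2 (by simp [hv])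
  have h1 := h fun _ => v
  have hr : rademacherSq K (fun _ : Fin 1 => v) = gauge K v ^ 2 := by
    have h2 : ∀ ε : Fin 1 → ℤˣ,
        gauge K (∑ i, ((ε i : ℤ) : ℝ) • v) = gauge K v := by
      intro ε
      rcases Int.units_eq_one_or (ε 0) with h3 | h3
      · simp [h3]
      · simp [h3, gauge_neg hK.neg_mem]
    rw [rademacherSq]
    simp only [h2, Finset.sum_const, Finset.card_univ, Fintype.card_fun, Fintype.card_units_int,
      Fintype.card_fin, nsmul_eq_mul]
    norm_num
    ring
  rw [hr] at h1
  simp only [Finset.univ_unique, Finset.sum_const, Finset.card_singleton, one_smul] at h1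
  rw [Real.sqrt_sq hpos.le, one_div, inv_mul_le_iff₀ hA] at h1
  nlinarith

theorem sqrt_sum_gauge_sq_le_average (hK : IsSymmConvexBody K) {k : ℕ}
    (x : Fin k → EuclideanSpace ℝ (Fin n)) :
    Real.sqrt (∑ i, gauge K (x i) ^ 2) ≤ Real.sqrt 2 * cotypeTwoConst K *
      (1 / 2 ^ k * ∑ ε : Fin k → ℤˣ, gauge K (∑ i, ((ε i : ℤ) : ℝ) • x i)) := by
  have hC : 0 ≤ cotypeTwoConst K :=
    Real.iSup_nonneg fun k => Real.sInf_nonneg fun c hc => hc.1.le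
  refine (hK.sqrt_sum_gauge_sq_le x).trans ?_
  rw [mul_comm (Real.sqrt 2), mul_assoc]
  refine mul_le_mul_of_nonneg_left ?_ hC
  have h0 : 0 ≤ ∑ ε : Fin k → ℤˣ, gauge K (∑ i, ((ε i : ℤ) : ℝ) • x i) :=
    Finset.sum_nonneg fun _ _ => gauge_nonneg _
  rw [Real.sqrt_le_left (by positivity), mul_pow, Real.sq_sqrt (by norm_num), rademacherSq]
  have h := hK.seminorm.sum_signs_sq_le x
  simp only [seminorm_apply] at h
  calc _ ≤ 1 / 2 ^ k * (2 * ((∑ ε : Fin k → ℤˣ,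
        gauge K (∑ i, ((ε i : ℤ) : ℝ) • x i)) ^ 2 / 2 ^ k)) := by gcongr
    _ = _ := by ring

end IsSymmConvexBody

/-! ### Cotype for independent symmetric random vectors -/

namespace IsSymmConvexBody

variable {n : ℕ} {K C : Set (EuclideanSpace ℝ (Fin n))}

/-- A cotype inequality for sums of independent symmetric random vectors `ℓ i (y i)`. -/
theorem sqrt_sum_sq_mul_integral_le (hK : IsSymmConvexBody K) {F : Type*} [AddCommGroup F]
    [MeasurableSpace F] [MeasurableNeg F] (μ : Measure F) [IsProbabilityMeasure μ]
    [μ.IsNegInvariant] {k : ℕ} (ℓ : Fin k → F → EuclideanSpace ℝ (Fin n))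
    (hℓ : ∀ i, Measurable (ℓ i)) (hneg : ∀ i y, ℓ i (-y) = -ℓ i y) {φ : F → ℝ}
    (hφ : Integrable φ μ) (a : Fin k → ℝ)
    (hgauge : ∀ i y, gauge K (ℓ i y) = a i * φ y) :
    Real.sqrt (∑ i, a i ^ 2) * ∫ y, φ y ∂μ ≤ Real.sqrt 2 * cotypeTwoConst K *
      ∫ x : Fin k → F, gauge K (∑ i, ℓ i (x i)) ∂(Measure.pi fun _ => μ) := by
  set ν : Measure (Fin k → F) := Measure.pi fun _ => μ with hν
  have hcont : Continuous (gauge K) := hK.continuous_seminorm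
  have hC : 0 ≤ cotypeTwoConst K :=
    Real.iSup_nonneg fun k => Real.sInf_nonneg fun c hc => hc.1.le
  set G : (Fin k → F) → ℝ := fun x => gauge K (∑ i, ℓ i (x i)) with hG
  have hℓ' : ∀ i, Measurable fun x : Fin k → F => ℓ i (x i) := fun i =>
    (hℓ i).comp (measurable_pi_apply i)
  have hGm : Measurable G := hcont.measurable.comp (Finset.measurable_fun_sum _ fun i _ => hℓ' i)
  have hφi : ∀ i, Integrable (fun x : Fin k → F => φ (x i)) ν := fun i => integrable_comp_eval hφ
  have hGi : Integrable G ν := by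
    refine (integrable_finsetSum Finset.univ fun i _ => (hφi i).const_mul (a i)).mono'
      hGm.aestronglyMeasurable (Filter.Eventually.of_forall fun x => ?_)
    rw [Real.norm_of_nonneg (gauge_nonneg _)]
    simp only [← hgauge]
    exact hK.seminorm.sum_le _ _
  -- Symmetry of `μ` makes the product measure invariant under every choice of signs. The sign is
  -- written as a case distinction since `F` carries no scalar multiplication.
  have hsign : ∀ ε : Fin k → ℤˣ,
      MeasurePreserving (fun x : Fin k → F => fun i => if ε i = 1 then x i else -x i) ν ν := by
    intro ε
    refine measurePreserving_pi (fun _ => μ) (fun _ => μ)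
      (f := fun i y => if ε i = 1 then y else -y) fun i => ?_
    by_cases h : ε i = 1
    · simp only [h, if_true]
      exact MeasurePreserving.id μ
    · simpa [h] using Measure.measurePreserving_neg μ
  have hval : ∀ (ε : Fin k → ℤˣ) (x : Fin k → F),
      G (fun i => if ε i = 1 then x i else -x i)
        = gauge K (∑ i, ((ε i : ℤ) : ℝ) • ℓ i (x i)) := by
    intro ε x
    simp only [hG]
    congr 1
    refine Finset.sum_congr rfl fun i _ => ?_
    rcases Int.units_eq_one_or (ε i) with h | h
    · simp [h]
    · simp [h, hneg]
  have hint : ∀ ε : Fin k → ℤˣ,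
      Integrable (fun x => gauge K (∑ i, ((ε i : ℤ) : ℝ) • ℓ i (x i))) ν := fun ε => by
    simpa only [Function.comp_def, hval] using (hsign ε).integrable_comp_of_integrable hGi
  have heq : ∀ ε : Fin k → ℤˣ,
      ∫ x, gauge K (∑ i, ((ε i : ℤ) : ℝ) • ℓ i (x i)) ∂ν = ∫ x, G x ∂ν := by
    intro ε
    have h := integral_map (μ := ν) (hsign ε).measurable.aemeasurable (f := G)
      hGm.aestronglyMeasurable
    rw [(hsign ε).map_eq] at h
    rw [h]
    simp only [hval]
  have havg : ∫ x, (1 / 2 ^ k * ∑ ε : Fin k → ℤˣ,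
      gauge K (∑ i, ((ε i : ℤ) : ℝ) • ℓ i (x i))) ∂ν = ∫ x, G x ∂ν := by
    rw [integral_const_mul, integral_finsetSum _ fun ε _ => hint ε]
    simp [heq]
  set N := Real.sqrt (∑ i, a i ^ 2) with hN
  have hNsq : N ^ 2 = ∑ i, a i ^ 2 := Real.sq_sqrt (by positivity)
  -- Cauchy–Schwarz for `a i` and `a i * φ (x i)` makes the left side linear in `φ`, so that it
  -- integrates to `N² ∫ φ`; one factor `N` is cancelled at the end.
  have hpt : ∀ x : Fin k → F, ∑ i, a i ^ 2 * φ (x i) ≤ N * (Real.sqrt 2 * cotypeTwoConst K *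
      (1 / 2 ^ k * ∑ ε : Fin k → ℤˣ, gauge K (∑ i, ((ε i : ℤ) : ℝ) • ℓ i (x i)))) := by
    intro x
    refine le_trans ?_ (mul_le_mul_of_nonneg_left
      (hK.sqrt_sum_gauge_sq_le_average fun i => ℓ i (x i)) (Real.sqrt_nonneg _))
    simp only [hgauge]
    rw [hN]
    refine le_trans (le_of_eq ?_) (Real.sum_mul_le_sqrt_mul_sqrt Finset.univ a _)
    exact Finset.sum_congr rfl fun i _ => by ring
  have hmain : N ^ 2 * ∫ y, φ y ∂μ
      ≤ N * (Real.sqrt 2 * cotypeTwoConst K * ∫ x, G x ∂ν) := by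
    have h := integral_mono (μ := ν)
      (integrable_finsetSum Finset.univ fun i _ => (hφi i).const_mul (a i ^ 2))
      ((((integrable_finsetSum Finset.univ fun ε _ => hint ε).const_mul (1 / 2 ^ k)).const_mul
        (Real.sqrt 2 * cotypeTwoConst K)).const_mul N) hpt
    rw [integral_finsetSum _ fun i _ => (hφi i).const_mul (a i ^ 2), integral_const_mul,
      integral_const_mul, havg] at h
    simp only [integral_const_mul] at h
    rw [hNsq, Finset.sum_mul]
    refine le_trans (le_of_eq (Finset.sum_congr rfl fun i _ => ?_)) h
    rw [integral_comp_eval (μ := fun _ => μ) hφ.aestronglyMeasurable]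
  rcases (Real.sqrt_nonneg (∑ i, a i ^ 2)).eq_or_lt with h0 | h0
  · rw [← hN] at h0
    rw [← h0, zero_mul]
    exact mul_nonneg (mul_nonneg (Real.sqrt_nonneg _) hC)
      (integral_nonneg fun _ => gauge_nonneg _)
  · refine le_of_mul_le_mul_left ?_ h0
    rw [← mul_assoc, ← hN, ← sq]
    exact hmain

end IsSymmConvexBody

/-! ### Uniform measures on convex bodies -/

/-- The uniform probability measure on `C`. -/
noncomputable def uniformMeasure {n : ℕ} (C : Set (EuclideanSpace ℝ (Fin n))) :
    Measure (EuclideanSpace ℝ (Fin n)) :=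
  (volume C)⁻¹ • volume.restrict C

namespace IsConvexBody

variable {n : ℕ} {C K : Set (EuclideanSpace ℝ (Fin n))}

theorem volume_ne_zero (hC : IsConvexBody C) : volume C ≠ 0 := by
  intro h
  exact (isOpen_interior.measure_pos volume hC.interior_nonempty).ne'
    (measure_mono_null interior_subset h)

theorem volume_ne_top (hC : IsConvexBody C) : volume C ≠ ⊤ := hC.isCompact.measure_lt_top.ne

theorem volume_real_pos (hC : IsConvexBody C) : 0 < volume.real C :=
  ENNReal.toReal_pos hC.volume_ne_zero hC.volume_ne_top

theorem isProbabilityMeasure (hC : IsConvexBody C) : IsProbabilityMeasure (uniformMeasure C) :=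
  ⟨by simp [uniformMeasure, ENNReal.inv_mul_cancel hC.volume_ne_zero hC.volume_ne_top]⟩

theorem integrable_of_continuous (hC : IsConvexBody C) {F : Type*} [NormedAddCommGroup F]
    {f : EuclideanSpace ℝ (Fin n) → F} (hf : Continuous f) : Integrable f (uniformMeasure C) :=
  Integrable.smul_measure (hf.continuousOn.integrableOn_compact hC.isCompact)
    (ENNReal.inv_ne_top.2 hC.volume_ne_zero)

theorem integral_uniformMeasure {C : Set (EuclideanSpace ℝ (Fin n))} {F : Type*}
    [NormedAddCommGroup F] [NormedSpace ℝ F]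
    (f : EuclideanSpace ℝ (Fin n) → F) :
    ∫ x, f x ∂(uniformMeasure C) = (volume.real C)⁻¹ • ∫ x in C, f x := by
  rw [uniformMeasure, integral_smul_measure, ENNReal.toReal_inv, Measure.real]

theorem pi_uniformMeasure (hC : IsConvexBody C) (s : ℕ) :
    (Measure.pi fun _ : Fin s => uniformMeasure C)
      = (volume C)⁻¹ ^ s • volume.restrict (Set.univ.pi fun _ : Fin s => C) := by
  have := hC.isProbabilityMeasure
  refine Measure.pi_eq (fun B _ => ?_)
  rw [volume_pi, Measure.restrict_pi_pi, Measure.smul_apply, Measure.pi_pi]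
  simp [uniformMeasure, Finset.prod_mul_distrib]

theorem multiNorm_eq_integral (hC : IsConvexBody C) {s : ℕ} (t : EuclideanSpace ℝ (Fin s)) :
    multiNorm (fun _ : Fin s => C) K t
      = ∫ x : Fin s → EuclideanSpace ℝ (Fin n), gauge K (∑ j, t j • x j)
          ∂(Measure.pi fun _ => uniformMeasure C) := by
  rw [hC.pi_uniformMeasure, integral_smul_measure, multiNorm]
  simp [Measure.real]

end IsConvexBody

/-! ### The lower bound -/

namespace IsSymmConvexBody

variable {n : ℕ} {K C : Set (EuclideanSpace ℝ (Fin n))}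

theorem isNegInvariant (hC : IsSymmConvexBody C) : (uniformMeasure C).IsNegInvariant := by
  refine ⟨?_⟩
  have hpre : Neg.neg ⁻¹' C = C := by
    ext x
    exact ⟨fun hx => by simpa using hC.neg_mem _ hx, fun hx => hC.neg_mem _ hx⟩
  have h := (Measure.measurePreserving_neg
    (volume : Measure (EuclideanSpace ℝ (Fin n)))).restrict_preimage hC.isCompact.measurableSet
  rw [hpre] at h
  rw [Measure.neg, uniformMeasure, Measure.map_smul, h.map_eq]

/-- Markov's inequality at half the radius at which the dilate of `K` has the volume of `C`. The set
where the gauge is below `r` lies in `r • K`, of volume `2⁻ⁿ vol C ≤ vol C / 2` as `n ≥ 1`, so the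
gauge is at least `r` on half of `C`. -/
theorem gauge_average_ge (hC : IsConvexBody C) (hK : IsSymmConvexBody K) (hn : 1 ≤ n) :
    (volume.real C / volume.real K) ^ (1 / (n : ℝ)) / 4 ≤ ∫ x, gauge K x ∂(uniformMeasure C) := by
  set v := volume.real C with hv
  set w := volume.real K with hw
  have hv0 : 0 < v := hC.volume_real_pos
  have hw0 : 0 < w := hK.volume_real_pos
  set r := (v / w) ^ (1 / (n : ℝ)) / 2 with hr
  have hr0 : 0 < r := by positivity
  have hprob := hC.isProbabilityMeasure
  have hcont : Continuous (gauge K) := hK.continuous_seminorm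
  have h1 := mul_meas_ge_le_integral_of_nonneg (μ := uniformMeasure C) (f := gauge K)
    (Filter.Eventually.of_forall fun _ => gauge_nonneg _) (hC.integrable_of_continuous hcont) r
  have hrn : r ^ n * w ≤ v / 2 := by
    have h2 : r ^ n = v / w / 2 ^ n := by
      rw [hr, div_pow, ← Real.rpow_natCast ((v / w) ^ (1 / (n : ℝ))), ← Real.rpow_mul (by positivity),
        one_div_mul_cancel (by positivity), Real.rpow_one]
    have h3 : (2 : ℝ) ≤ 2 ^ n := by
      simpa using pow_le_pow_right₀ (one_le_two : (1 : ℝ) ≤ 2) hn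
    rw [h2, div_right_comm, div_mul_cancel₀ _ hw0.ne']
    gcongr
  have hsmall : (uniformMeasure C).real {x | r ≤ gauge K x}ᶜ ≤ 1 / 2 := by
    have hsub : {x | r ≤ gauge K x}ᶜ ⊆ r • K := by
      intro x hx
      obtain ⟨b, hb0, hbr, y, hy, rfl⟩ := exists_lt_of_gauge_lt hK.absorbent (not_le.1 hx)
      refine ⟨(b / r) • y, ?_, ?_⟩
      · exact hK.balanced.smul_mem (by
          rw [Real.norm_of_nonneg (by positivity)]; exact (div_le_one hr0).2 hbr.le) hy
      · simp only [smul_smul]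
        rw [mul_div_cancel₀ _ hr0.ne']
    have hvol : volume.real (r • K) = r ^ n * w := by
      rw [Measure.real, Measure.addHaar_smul_of_nonneg _ hr0.le, ENNReal.toReal_mul,
        ENNReal.toReal_ofReal (by positivity), finrank_euclideanSpace_fin]
      rfl
    calc (uniformMeasure C).real {x | r ≤ gauge K x}ᶜ
        ≤ (uniformMeasure C).real (r • K) := measureReal_mono hsub
      _ = v⁻¹ * (volume.restrict C).real (r • K) := by
          simp [uniformMeasure, Measure.real, hv]
      _ ≤ v⁻¹ * volume.real (r • K) := by
          have : volume (r • K) ≠ ⊤ := (hK.isCompact.smul r).measure_lt_top.ne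
          gcongr
          exact ENNReal.toReal_mono this (Measure.restrict_apply_le _ _)
      _ ≤ v⁻¹ * (v / 2) := by rw [hvol]; gcongr
      _ = 1 / 2 := by field_simp
  have hbig : 1 / 2 ≤ (uniformMeasure C).real {x | r ≤ gauge K x} := by
    have hm : MeasurableSet {x | r ≤ gauge K x} :=
      measurableSet_le measurable_const hcont.measurable
    have := probReal_compl_eq_one_sub (μ := uniformMeasure C) hm
    linarith
  calc (v / w) ^ (1 / (n : ℝ)) / 4 = r * (1 / 2) := by rw [hr]; ring
    _ ≤ r * (uniformMeasure C).real {x | r ≤ gauge K x} := by gcongr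
    _ ≤ _ := h1

theorem multiNorm_ge (hC : IsSymmConvexBody C) (hK : IsSymmConvexBody K) (hn : 1 ≤ n) {s : ℕ}
    (t : EuclideanSpace ℝ (Fin s)) :
    1 / 8 / cotypeTwoConst K * (volume.real C / volume.real K) ^ (1 / (n : ℝ)) * ‖t‖
      ≤ multiNorm (fun _ : Fin s => C) K t := by
  have := hC.isProbabilityMeasure
  have := hC.isNegInvariant
  have hcont : Continuous (gauge K) := hK.continuous_seminorm
  have hcot := hK.one_le_cotypeTwoConst hn
  have h := hK.sqrt_sum_sq_mul_integral_le (uniformMeasure C) (fun (j : Fin s) x => t j • x)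
    (fun j => measurable_const_smul _) (fun j y => smul_neg _ _) (φ := gauge K)
    (hC.integrable_of_continuous hcont) (fun j => |t j|)
    (fun j y => map_smul_eq_mul hK.seminorm _ _)
  rw [← hC.multiNorm_eq_integral] at h
  simp only [sq_abs] at h
  have ht : Real.sqrt (∑ j, t j ^ 2) = ‖t‖ := by simp [EuclideanSpace.norm_eq]
  rw [ht] at h
  -- Bounding `√2` by 2 turns the factor 1/4 of `gauge_average_ge` into 1/8.
  have h2 : Real.sqrt 2 ≤ 2 := by
    rw [Real.sqrt_le_left (by norm_num)]; norm_num
  have h3 := mul_le_mul_of_nonneg_left (gauge_average_ge hC.toIsConvexBody hK hn) (norm_nonneg t)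
  have hm : 0 ≤ multiNorm (fun _ : Fin s => C) K t := by
    rw [hC.multiNorm_eq_integral]
    exact integral_nonneg fun _ => gauge_nonneg _
  have h4 : Real.sqrt 2 * cotypeTwoConst K * multiNorm (fun _ : Fin s => C) K t
      ≤ 2 * cotypeTwoConst K * multiNorm (fun _ : Fin s => C) K t := by gcongr
  have h5 := h3.trans (h.trans h4)
  have h6 : 1 / 8 / cotypeTwoConst K * (volume.real C / volume.real K) ^ (1 / (n : ℝ)) * ‖t‖
      = (‖t‖ * ((volume.real C / volume.real K) ^ (1 / (n : ℝ)) / 4))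
        / (2 * cotypeTwoConst K) := by
    field_simp
    ring
  rw [h6, div_le_iff₀ (by positivity)]
  linarith

end IsSymmConvexBody

/-! ### Integrals as finite averages -/

section ConvexHull

variable {V : Type*} [NormedAddCommGroup V] [NormedSpace ℝ V] [FiniteDimensional ℝ V]

theorem IsCompact.convexHull_of_finiteDimensional {s : Set V} (hs : IsCompact s) :
    IsCompact (convexHull ℝ s) := by
  let f : (k : ℕ) → (Fin k → ℝ) × (Fin k → V) → V := fun k q => ∑ i, q.1 i • q.2 i
  have hf : ∀ k, Continuous (f k) := fun k => by fun_prop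
  -- By Carathéodory at most `finrank + 1` points are needed, so the hull is a finite union of
  -- continuous images of compact sets.
  have heq : convexHull ℝ s = ⋃ k ∈ Finset.range (Module.finrank ℝ V + 2),
      f k '' (stdSimplex ℝ (Fin k) ×ˢ Set.univ.pi fun _ => s) := by
    apply Set.Subset.antisymm
    · intro x hx
      obtain ⟨ι, hι, z, w, hz, haff, hw, hw1, hx⟩ := eq_pos_convex_span_of_mem_convexHull hx
      let e := Fintype.equivFin ι
      refine Set.mem_biUnion (x := Fintype.card ι) ?_
        ⟨(w ∘ e.symm, z ∘ e.symm), ⟨⟨fun i => (hw _).le, ?_⟩, fun i _ => hz ⟨_, rfl⟩⟩, ?_⟩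
      · have h := haff.card_le_finrank_succ
        have h2 := Submodule.finrank_le (vectorSpan ℝ (Set.range z))
        simp only [Finset.coe_range, Set.mem_Iio]
        omega
      · rw [← hw1]
        exact e.symm.sum_comp w
      · rw [← hx]
        exact e.symm.sum_comp fun i => w i • z i
    · refine Set.iUnion₂_subset fun k _ => ?_
      rintro _ ⟨⟨w, z⟩, ⟨⟨hw0, hw1⟩, hz⟩, rfl⟩
      exact (convex_convexHull ℝ s).sum_mem (fun i _ => hw0 i) hw1
        fun i _ => subset_convexHull ℝ s (hz i trivial)
  rw [heq]
  refine (Finset.range _).isCompact_biUnion fun k _ => ?_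
  exact ((isCompact_stdSimplex ℝ (Fin k)).prod (isCompact_univ_pi fun _ => hs)).image (hf k)

/-- The integral of `Φ` lies in the convex hull of the image of `S`, which is compact and hence
closed. -/
theorem exists_finite_average_eq_integral {Ω : Type*} [TopologicalSpace Ω] [MeasurableSpace Ω]
    (μ : Measure Ω) [IsProbabilityMeasure μ] {S : Set Ω} (hS : IsCompact S)
    (hμS : ∀ᵐ x ∂μ, x ∈ S) {Φ : Ω → V} (hΦ : ContinuousOn Φ S) (hΦi : Integrable Φ μ) :
    ∃ (k : ℕ) (w : Fin k → ℝ) (x : Fin k → Ω), (∀ i, 0 ≤ w i) ∧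
      ∑ i, w i • Φ (x i) = ∫ x, Φ x ∂μ := by
  have hcomp := (hS.image_of_continuousOn hΦ).convexHull_of_finiteDimensional
  have hmem : ∫ x, Φ x ∂μ ∈ convexHull ℝ (Φ '' S) := by
    refine (convex_convexHull ℝ _).integral_mem hcomp.isClosed ?_ hΦi
    filter_upwards [hμS] with x hx
    exact subset_convexHull ℝ _ ⟨x, hx, rfl⟩
  obtain ⟨ι, hι, z, w, hz, -, hw, -, hx⟩ := eq_pos_convex_span_of_mem_convexHull hmem
  choose y hyS hy using fun i => hz ⟨i, rfl⟩
  let e := Fintype.equivFin ι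
  refine ⟨Fintype.card ι, w ∘ e.symm, y ∘ e.symm, fun i => (hw _).le, ?_⟩
  rw [← hx]
  simp only [Function.comp_apply, hy]
  exact e.symm.sum_comp fun i => w i • z i

end ConvexHull

/-! ### Gaussian vectors and the spherical mean -/

section Gaussian

variable {n : ℕ}

/-- Polar coordinates, with `f x = ‖x‖ f(x/‖x‖)`. The radial factor does not depend on `f`, which
allows two homogeneous functions to be compared. -/
theorem integral_homogeneous_mul_radial {f : EuclideanSpace ℝ (Fin n) → ℝ}
    (hf : ∀ (r : ℝ) (x : EuclideanSpace ℝ (Fin n)), 0 < r → f (r • x) = r * f x)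
    (hf0 : f 0 = 0) (ρ : ℝ → ℝ) :
    ∫ x, f x * ρ ‖x‖ = (∫ ξ : Metric.sphere (0 : EuclideanSpace ℝ (Fin n)) 1,
        f (ξ : EuclideanSpace ℝ (Fin n)) ∂(volume : Measure (EuclideanSpace ℝ (Fin n))).toSphere)
      * ∫ r : Set.Ioi (0 : ℝ), r * ρ r ∂(Measure.volumeIoiPow (n - 1)) := by
  have hmp := (volume : Measure (EuclideanSpace ℝ (Fin n))).measurePreserving_homeomorphUnitSphereProd
  rw [finrank_euclideanSpace_fin] at hmp
  have h1 : ∫ x, f x * ρ ‖x‖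
      = ∫ x : ({0}ᶜ : Set (EuclideanSpace ℝ (Fin n))), f x * ρ ‖(x : EuclideanSpace ℝ (Fin n))‖
          ∂(volume.comap Subtype.val) := by
    rw [integral_subtype_comap (measurableSet_singleton _).compl fun x => f x * ρ ‖x‖]
    refine (setIntegral_eq_integral_of_forall_compl_eq_zero fun x hx => ?_).symm
    have : x = 0 := by simpa using hx
    simp [this, hf0]
  rw [h1, ← integral_prod_mul, ← hmp.integral_comp (Homeomorph.measurableEmbedding _)]
  refine integral_congr_ae (Filter.Eventually.of_forall fun x => ?_)
  have hx : (x : EuclideanSpace ℝ (Fin n)) ≠ 0 := x.2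
  have hpos : 0 < ‖(x : EuclideanSpace ℝ (Fin n))‖ := norm_pos_iff.2 hx
  simp only [homeomorphUnitSphereProd_apply_fst_coe, homeomorphUnitSphereProd_apply_snd_coe]
  rw [hf _ _ (inv_pos.2 hpos)]
  field_simp

/-- The density of the standard Gaussian measure as a function of the norm. -/
noncomputable def gaussianRadial (n : ℕ) (r : ℝ) : ℝ :=
  ((2 * Real.pi) ^ ((n : ℝ) / 2))⁻¹ * Real.exp (-(1 / 2) * r ^ 2)

theorem gaussianRadial_nonneg (n : ℕ) (r : ℝ) : 0 ≤ gaussianRadial n r := by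
  unfold gaussianRadial; positivity

theorem continuous_gaussianRadial (n : ℕ) : Continuous (gaussianRadial n) := by
  unfold gaussianRadial; fun_prop

theorem integrable_gaussianRadial_norm :
    Integrable fun x : EuclideanSpace ℝ (Fin n) => gaussianRadial n ‖x‖ := by
  have h := GaussianFourier.integrable_cexp_neg_mul_sq_norm_add (V := EuclideanSpace ℝ (Fin n))
    (b := (1 / 2 : ℝ)) (by norm_num) 0 0
  have h2 := (h.norm).const_mul ((2 * Real.pi) ^ ((n : ℝ) / 2))⁻¹
  refine h2.congr (Filter.Eventually.of_forall fun x => ?_)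
  simp only [gaussianRadial, Complex.norm_exp]
  norm_num
  norm_cast
  exact Or.inl rfl

/-- Equality of characteristic functions. The density is what makes polar coordinates applicable. -/
theorem stdGaussian_eq_withDensity :
    stdGaussian (EuclideanSpace ℝ (Fin n))
      = volume.withDensity fun x => ENNReal.ofReal (gaussianRadial n ‖x‖) := by
  have hcont : Continuous fun x : EuclideanSpace ℝ (Fin n) => gaussianRadial n ‖x‖ :=
    (continuous_gaussianRadial n).comp continuous_norm
  have : IsFiniteMeasure (volume.withDensity
      fun x : EuclideanSpace ℝ (Fin n) => ENNReal.ofReal (gaussianRadial n ‖x‖)) :=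
    isFiniteMeasure_withDensity_ofReal integrable_gaussianRadial_norm.2
  refine Measure.ext_of_charFun ?_
  ext t
  rw [charFun_stdGaussian, charFun_apply,
    integral_withDensity_eq_integral_toReal_smul hcont.measurable.ennreal_ofReal (by simp)]
  have h := GaussianFourier.integral_cexp_neg_mul_sq_norm_add (V := EuclideanSpace ℝ (Fin n))
    (b := (1 / 2 : ℂ)) (by norm_num) Complex.I t
  rw [finrank_euclideanSpace_fin] at h
  have h2 : ∀ x : EuclideanSpace ℝ (Fin n),
      (ENNReal.ofReal (gaussianRadial n ‖x‖)).toReal • Complex.exp (inner ℝ x t * Complex.I)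
      = ((2 * Real.pi : ℝ) ^ ((n : ℝ) / 2) : ℝ)⁻¹ *
        Complex.exp (-(1 / 2 : ℂ) * ‖x‖ ^ 2 + Complex.I * inner ℝ t x) := by
    intro x
    rw [ENNReal.toReal_ofReal (gaussianRadial_nonneg _ _), gaussianRadial, Complex.real_smul,
      Complex.exp_add, real_inner_comm]
    push_cast
    rw [mul_comm Complex.I]
    ring
  simp only [h2]
  rw [integral_const_mul, h]
  have h3 : ((Real.pi : ℂ) / (1 / 2)) ^ ((n : ℂ) / 2)
      = (((2 * Real.pi : ℝ) ^ ((n : ℝ) / 2) : ℝ) : ℂ) := by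
    rw [Complex.ofReal_cpow (by positivity)]
    push_cast
    congr 1
    ring
  have h4 : (((2 * Real.pi : ℝ) ^ ((n : ℝ) / 2) : ℝ) : ℂ) ≠ 0 := by
    rw [Complex.ofReal_ne_zero]; positivity
  rw [h3, Complex.ofReal_inv, ← mul_assoc, inv_mul_cancel₀ h4, one_mul, Complex.I_sq]
  congr 1
  ring

theorem integral_stdGaussian_homogeneous {f : EuclideanSpace ℝ (Fin n) → ℝ}
    (hf : ∀ (r : ℝ) (x : EuclideanSpace ℝ (Fin n)), 0 < r → f (r • x) = r * f x)
    (hf0 : f 0 = 0) :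
    ∫ x, f x ∂(stdGaussian (EuclideanSpace ℝ (Fin n)))
      = (∫ ξ : Metric.sphere (0 : EuclideanSpace ℝ (Fin n)) 1,
        f (ξ : EuclideanSpace ℝ (Fin n)) ∂(volume : Measure (EuclideanSpace ℝ (Fin n))).toSphere)
      * ∫ r : Set.Ioi (0 : ℝ), r * gaussianRadial n r ∂(Measure.volumeIoiPow (n - 1)) := by
  have hcont : Continuous fun x : EuclideanSpace ℝ (Fin n) => gaussianRadial n ‖x‖ :=
    (continuous_gaussianRadial n).comp continuous_norm
  rw [← integral_homogeneous_mul_radial hf hf0, stdGaussian_eq_withDensity,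
    integral_withDensity_eq_integral_toReal_smul hcont.measurable.ennreal_ofReal (by simp)]
  refine integral_congr_ae (Filter.Eventually.of_forall fun x => ?_)
  simp only [ENNReal.toReal_ofReal (gaussianRadial_nonneg _ _), smul_eq_mul]
  ring

theorem integral_norm_sq_stdGaussian :
    ∫ x, ‖x‖ ^ 2 ∂(stdGaussian (EuclideanSpace ℝ (Fin n))) = n := by
  have hsq : ∫ x, x ^ 2 ∂(gaussianReal 0 1) = 1 := by
    have h := variance_of_integral_eq_zero (μ := gaussianReal 0 1) (X := id) (by fun_prop)
      (by simp)
    rw [variance_id_gaussianReal] at h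
    simpa using h.symm
  have hint : Integrable (fun x : ℝ => x ^ 2) (gaussianReal 0 1) :=
    (IsGaussian.memLp_two_id (μ := gaussianReal 0 1)).integrable_sq
  rw [← map_pi_eq_stdGaussian, integral_map (by fun_prop) (by fun_prop)]
  simp only [EuclideanSpace.real_norm_sq_eq]
  rw [integral_finsetSum _ fun i _ => integrable_comp_eval
    (μ := fun _ : Fin n => gaussianReal 0 1) (f := fun x : ℝ => x ^ 2) hint]
  have h2 : ∀ i : Fin n, ∫ x : Fin n → ℝ, x i ^ 2 ∂(Measure.pi fun _ => gaussianReal 0 1) = 1 :=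
    fun i => by
      rw [integral_comp_eval (μ := fun _ : Fin n => gaussianReal 0 1) (f := fun x : ℝ => x ^ 2)
        hint.aestronglyMeasurable, hsq]
  simp [h2]

theorem integral_le_sqrt_integral_sq {Ω : Type*} [MeasurableSpace Ω] {μ : Measure Ω}
    [IsProbabilityMeasure μ] {f : Ω → ℝ} (hf : MemLp f 2 μ) :
    ∫ x, f x ∂μ ≤ Real.sqrt (∫ x, f x ^ 2 ∂μ) := by
  refine Real.le_sqrt_of_sq_le ?_
  have h1 := variance_eq_sub hf
  have h2 := variance_nonneg f μ
  simp only [Pi.pow_apply] at h1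
  linarith

theorem integral_norm_stdGaussian_le :
    ∫ x, ‖x‖ ∂(stdGaussian (EuclideanSpace ℝ (Fin n))) ≤ Real.sqrt n := by
  rw [← integral_norm_sq_stdGaussian]
  exact integral_le_sqrt_integral_sq
    (IsGaussian.memLp_two_id (μ := stdGaussian (EuclideanSpace ℝ (Fin n)))).norm

theorem sphereMean_nonneg (K : Set (EuclideanSpace ℝ (Fin n))) : 0 ≤ sphereMean K := by
  unfold sphereMean
  rw [average_eq]
  exact smul_nonneg (by positivity) (integral_nonneg fun _ => gauge_nonneg _)

theorem integral_gauge_stdGaussian_le (hn : 1 ≤ n) (K : Set (EuclideanSpace ℝ (Fin n))) :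
    ∫ x, gauge K x ∂(stdGaussian (EuclideanSpace ℝ (Fin n))) ≤ Real.sqrt n * sphereMean K := by
  have : Nonempty (Fin n) := ⟨⟨0, hn⟩⟩
  have : Nontrivial (EuclideanSpace ℝ (Fin n)) := inferInstance
  set σ := (volume : Measure (EuclideanSpace ℝ (Fin n))).toSphere with hσ
  have h1 := integral_stdGaussian_homogeneous (f := gauge K)
    (fun r x hr => gauge_smul_of_nonneg hr.le x) gauge_zero
  have h2 := integral_stdGaussian_homogeneous (n := n) (f := fun x => ‖x‖)
    (fun r x hr => by rw [norm_smul, Real.norm_of_nonneg hr.le]) norm_zero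
  have hσ0 : 0 < σ.real Set.univ := by
    rw [Measure.real, ENNReal.toReal_pos_iff]
    exact ⟨(Measure.measure_univ_pos (μ := σ)).2 (Measure.toSphere_ne_zero _), measure_lt_top _ _⟩
  -- The gauge and the Euclidean norm share the radial factor, and the norm is 1 on the sphere, so
  -- the ratio of their Gaussian means is the normalized spherical mean.
  have h3 : ∫ x, gauge K x ∂(stdGaussian (EuclideanSpace ℝ (Fin n)))
      = (∫ x, ‖x‖ ∂(stdGaussian (EuclideanSpace ℝ (Fin n)))) * sphereMean K := by
    rw [h1, h2, sphereMean, average_eq, ← hσ]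
    simp only [norm_eq_of_mem_sphere, integral_const, smul_eq_mul, mul_one]
    field_simp
  rw [h3]
  exact mul_le_mul_of_nonneg_right integral_norm_stdGaussian_le (sphereMean_nonneg K)

/-- A centred Gaussian law is determined by its covariance: both characteristic functions equal
`exp(-c²‖ξ‖²/2)`. -/
theorem map_sum_smul_gaussian {k : ℕ} (v : Fin k → EuclideanSpace ℝ (Fin n)) {c : ℝ}
    (hv : ∀ ξ : EuclideanSpace ℝ (Fin n), ∑ i, (inner ℝ (v i) ξ) ^ 2 = c ^ 2 * ‖ξ‖ ^ 2) :
    (Measure.pi fun _ : Fin k => gaussianReal 0 1).map (fun x => ∑ i, x i • v i)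
      = (stdGaussian (EuclideanSpace ℝ (Fin n))).map (fun y => c • y) := by
  have : IsProbabilityMeasure ((Measure.pi fun _ : Fin k => gaussianReal 0 1).map
      (fun x => ∑ i, x i • v i)) :=
    Measure.isProbabilityMeasure_map (Measurable.aemeasurable (by fun_prop))
  have : IsProbabilityMeasure ((stdGaussian (EuclideanSpace ℝ (Fin n))).map (fun y => c • y)) :=
    Measure.isProbabilityMeasure_map (Measurable.aemeasurable (by fun_prop))
  refine Measure.ext_of_charFun ?_
  ext t
  rw [charFun_map_smul, charFun_stdGaussian, charFun_apply,
    integral_map (Measurable.aemeasurable (by fun_prop))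
    (Measurable.aestronglyMeasurable (by fun_prop))]
  simp_rw [sum_inner, Complex.ofReal_sum, Finset.sum_mul, Complex.exp_sum,
    integral_fintype_prod_eq_prod
      (f := fun i x ↦ Complex.exp (inner ℝ (x • v i) t * Complex.I)),
    real_inner_smul_left, mul_comm _ (inner ℝ _ _), Complex.ofReal_mul, ← charFun_apply_real,
    charFun_gaussianReal]
  simp only [Complex.ofReal_zero, mul_zero, zero_mul, NNReal.coe_one, Complex.ofReal_one, one_mul,
    zero_sub]
  rw [← Complex.exp_sum, Finset.sum_neg_distrib, ← Finset.sum_div]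
  simp_rw [← Complex.ofReal_pow]
  rw [← Complex.ofReal_sum, hv, norm_smul, mul_pow, Real.norm_eq_abs, sq_abs]
  congr 1
  push_cast
  ring

/-- This mean is a denominator in the upper constant. If it vanished, the variable would be almost
surely 0, against variance 1. -/
theorem integral_abs_gaussianReal_pos : 0 < ∫ x, |x| ∂(gaussianReal 0 1) := by
  have hint : Integrable (fun x : ℝ => |x|) (gaussianReal 0 1) :=
    (IsGaussian.integrable_id (μ := gaussianReal 0 1)).abs
  refine (integral_nonneg fun _ => abs_nonneg _).lt_of_ne fun h => ?_
  have h1 := (integral_eq_zero_iff_of_nonneg (fun _ => abs_nonneg _) hint).1 h.symm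
  have hv : ∫ x, x ^ 2 ∂(gaussianReal 0 1) = 0 := by
    refine integral_eq_zero_of_ae ?_
    filter_upwards [h1] with x hx
    have : x = 0 := by simpa using hx
    simp [this]
  have h2 := variance_of_integral_eq_zero (μ := gaussianReal 0 1) (X := id) (by fun_prop)
    (by simp)
  rw [variance_id_gaussianReal] at h2
  simp only [id] at h2
  rw [hv] at h2
  simp at h2

end Gaussian

/-! ### Isotropic bodies and the upper bound -/

namespace IsIsotropic

variable {n : ℕ} {C : Set (EuclideanSpace ℝ (Fin n))}

theorem integral_inner_sq (hC : IsIsotropic C) {L : ℝ}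
    (h : ∀ ξ : EuclideanSpace ℝ (Fin n), ‖ξ‖ = 1 → ∫ x in C, (inner ℝ x ξ) ^ 2 = L ^ 2)
    (ξ : EuclideanSpace ℝ (Fin n)) :
    ∫ x, (inner ℝ x ξ) ^ 2 ∂(uniformMeasure C) = L ^ 2 * ‖ξ‖ ^ 2 := by
  rw [IsConvexBody.integral_uniformMeasure, Measure.real, hC.volume_eq_one]
  simp only [ENNReal.toReal_one, inv_one, one_smul]
  rcases eq_or_ne ξ 0 with rfl | hξ
  · simp
  · have hpos : 0 < ‖ξ‖ := norm_pos_iff.2 hξ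
    have h1 := h (‖ξ‖⁻¹ • ξ) (by rw [norm_smul, norm_inv, norm_norm, inv_mul_cancel₀ hpos.ne'])
    simp only [inner_smul_right, mul_pow] at h1
    rw [integral_const_mul] at h1
    rw [← h1]
    field_simp

theorem integral_inner (hC : IsIsotropic C) (ξ : EuclideanSpace ℝ (Fin n)) :
    ∫ x, inner ℝ x ξ ∂(uniformMeasure C) = 0 := by
  have h1 := (innerSL ℝ ξ).integral_comp_comm (hC.integrable_of_continuous continuous_id)
  simp only [innerSL_apply_apply, id] at h1
  simp_rw [real_inner_comm ξ]
  rw [h1, IsConvexBody.integral_uniformMeasure, hC.barycenter_eq_zero]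
  simp

/-- The variables `t j * ⟨x j, ξ⟩` are independent and centred, so their variances add. -/
theorem integral_inner_sum_sq (hC : IsIsotropic C) {L : ℝ}
    (h : ∀ ξ : EuclideanSpace ℝ (Fin n), ‖ξ‖ = 1 → ∫ x in C, (inner ℝ x ξ) ^ 2 = L ^ 2)
    {s : ℕ} (t : EuclideanSpace ℝ (Fin s)) (ξ : EuclideanSpace ℝ (Fin n)) :
    ∫ x : Fin s → EuclideanSpace ℝ (Fin n), (inner ℝ (∑ j, t j • x j) ξ) ^ 2
      ∂(Measure.pi fun _ => uniformMeasure C) = (L * ‖t‖) ^ 2 * ‖ξ‖ ^ 2 := by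
  have := hC.isProbabilityMeasure
  let X : Fin s → EuclideanSpace ℝ (Fin n) → ℝ := fun j x => t j * inner ℝ x ξ
  have hXc : ∀ j, Continuous (X j) := fun j => by fun_prop
  have hX2 : ∀ j, MemLp (X j) 2 (uniformMeasure C) := fun j =>
    (memLp_two_iff_integrable_sq (hXc j).aestronglyMeasurable).2
      (hC.integrable_of_continuous ((hXc j).pow 2))
  have hX0 : ∀ j, ∫ x, X j x ∂(uniformMeasure C) = 0 := fun j => by
    simp only [X]
    rw [integral_const_mul, hC.integral_inner, mul_zero]
  have hvar : ∀ j, Var[X j; uniformMeasure C] = t j ^ 2 * (L ^ 2 * ‖ξ‖ ^ 2) := fun j => by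
    rw [variance_of_integral_eq_zero (hXc j).aemeasurable (hX0 j), ← hC.integral_inner_sq h,
      ← integral_const_mul]
    simp only [X, mul_pow]
  have hsum : (fun x : Fin s → EuclideanSpace ℝ (Fin n) => inner ℝ (∑ j, t j • x j) ξ)
      = ∑ j, fun x : Fin s → EuclideanSpace ℝ (Fin n) => X j (x j) := by
    ext x
    simp [X, sum_inner, inner_smul_left]
  have hmean : ∫ x, (∑ j, fun x : Fin s → EuclideanSpace ℝ (Fin n) => X j (x j)) x
      ∂(Measure.pi fun _ => uniformMeasure C) = 0 := by
    simp only [Finset.sum_apply]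
    rw [integral_finsetSum _ fun j _ => integrable_comp_eval (μ := fun _ : Fin s => uniformMeasure C)
      (hC.integrable_of_continuous (hXc j))]
    refine Finset.sum_eq_zero fun j _ => ?_
    rw [integral_comp_eval (μ := fun _ : Fin s => uniformMeasure C) (hXc j).aestronglyMeasurable,
      hX0]
  have h1 := variance_sum_pi (μ := fun _ : Fin s => uniformMeasure C) hX2
  rw [variance_of_integral_eq_zero (by fun_prop) hmean, ← hsum] at h1
  rw [h1]
  simp only [hvar]
  rw [← Finset.sum_mul, ← EuclideanSpace.real_norm_sq_eq]
  ring

/-- The upper bound: the law of `∑ j, t j • x j` is replaced by a finitely supported one with the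
same second moments, which is compared to a Gaussian vector by the cotype inequality. -/
theorem multiNorm_le (hC : IsIsotropic C) {K : Set (EuclideanSpace ℝ (Fin n))}
    (hK : IsSymmConvexBody K) (hn : 1 ≤ n) {s : ℕ} (t : EuclideanSpace ℝ (Fin s)) :
    multiNorm (fun _ : Fin s => C) K t ≤ Real.sqrt 2 / (∫ x, |x| ∂(gaussianReal 0 1)) *
      isotropicConst C * cotypeTwoConst K * Real.sqrt n * sphereMean K * ‖t‖ := by
  obtain ⟨L, hL, h⟩ := hC.inertia
  have := hC.isProbabilityMeasure
  rw [isotropicConst_eq hn hC hL h, hC.multiNorm_eq_integral]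
  set ν := Measure.pi fun _ : Fin s => uniformMeasure C with hν
  have hcont : Continuous (gauge K) := hK.continuous_seminorm
  have hz := integral_abs_gaussianReal_pos
  set z := ∫ x, |x| ∂(gaussianReal 0 1) with hzdef
  set S : Set (Fin s → EuclideanSpace ℝ (Fin n)) := Set.univ.pi fun _ => C with hS
  have hScomp : IsCompact S := isCompact_univ_pi fun _ => hC.isCompact
  have hνeq := hC.pi_uniformMeasure s
  have hνS : ∀ᵐ x ∂ν, x ∈ S := by
    rw [hν, hνeq]
    exact Measure.ae_smul_measure (ae_restrict_mem hScomp.measurableSet) _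
  have hint : ∀ {F : Type} [NormedAddCommGroup F]
      {f : (Fin s → EuclideanSpace ℝ (Fin n)) → F}, Continuous f → Integrable f ν := by
    intro F _ f hf
    rw [hν, hνeq]
    exact Integrable.smul_measure (hf.continuousOn.integrableOn_compact hScomp)
      (ENNReal.pow_ne_top (ENNReal.inv_ne_top.2 hC.volume_ne_zero))
  let X : (Fin s → EuclideanSpace ℝ (Fin n)) → EuclideanSpace ℝ (Fin n) :=
    fun x => ∑ j, t j • x j
  have hXc : Continuous X := by fun_prop
  have hpX : Continuous fun x => gauge K (X x) := hcont.comp hXc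
  -- `Φ` records precisely the moments the finite average must preserve: `‖X‖_K²` and all products
  -- of coordinates of `X`.
  let Φ : (Fin s → EuclideanSpace ℝ (Fin n)) → ℝ × (Fin n → Fin n → ℝ) :=
    fun x => (gauge K (X x) ^ 2, fun i j => X x i * X x j)
  have hΦ : Continuous Φ := (hpX.pow 2).prodMk (by fun_prop)
  obtain ⟨k, w, x, hw, hwx⟩ := exists_finite_average_eq_integral ν hScomp hνS hΦ.continuousOn
    (hint hΦ)
  have hfun : ∀ Λ : (ℝ × (Fin n → Fin n → ℝ)) →ₗ[ℝ] ℝ,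
      ∑ i, w i * Λ (Φ (x i)) = ∫ y, Λ (Φ y) ∂ν := by
    intro Λ
    have h1 := (LinearMap.toContinuousLinearMap Λ).integral_comp_comm (hint hΦ)
    simp only [LinearMap.coe_toContinuousLinearMap'] at h1
    rw [h1, ← hwx]
    simp
  have hsq : ∑ i, w i * gauge K (X (x i)) ^ 2 = ∫ y, gauge K (X y) ^ 2 ∂ν :=
    hfun (LinearMap.fst ℝ ℝ _)
  have hinner : ∀ ξ : EuclideanSpace ℝ (Fin n),
      ∑ i, w i * (inner ℝ (X (x i)) ξ) ^ 2 = (L * ‖t‖) ^ 2 * ‖ξ‖ ^ 2 := by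
    intro ξ
    -- The quadratic form of `ξ` is linear in the matrix entry, and recovers `⟨X, ξ⟩²` from `Φ`.
    let Λ : (ℝ × (Fin n → Fin n → ℝ)) →ₗ[ℝ] ℝ :=
      { toFun := fun q => ∑ i, ∑ j, ξ i * ξ j * q.2 i j
        map_add' := fun q r => by
          simp only [Prod.snd_add, Pi.add_apply, mul_add, Finset.sum_add_distrib]
        map_smul' := fun c q => by
          simp only [Prod.smul_snd, Pi.smul_apply, smul_eq_mul, RingHom.id_apply, Finset.mul_sum]
          exact Finset.sum_congr rfl fun i _ => Finset.sum_congr rfl fun j _ => by ring }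
    have hΛ : ∀ y, Λ (Φ y) = (inner ℝ (X y) ξ) ^ 2 := by
      intro y
      simp only [Λ, Φ, LinearMap.coe_mk, AddHom.coe_mk, PiLp.inner_apply, RCLike.inner_apply,
        conj_trivial, sq, Finset.sum_mul_sum]
      exact Finset.sum_congr rfl fun i _ => Finset.sum_congr rfl fun j _ => by ring
    rw [← hC.integral_inner_sum_sq h t ξ]
    simpa only [hΛ] using hfun Λ
  -- All the preserved quantities are quadratic, so the weights can be absorbed as square roots.
  let v : Fin k → EuclideanSpace ℝ (Fin n) := fun i => Real.sqrt (w i) • X (x i)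
  have hv : ∀ ξ : EuclideanSpace ℝ (Fin n),
      ∑ i, (inner ℝ (v i) ξ) ^ 2 = (L * ‖t‖) ^ 2 * ‖ξ‖ ^ 2 := by
    intro ξ
    rw [← hinner]
    refine Finset.sum_congr rfl fun i _ => ?_
    rw [real_inner_smul_left, mul_pow, Real.sq_sqrt (hw i)]
  have hgv : ∀ i, gauge K (v i) ^ 2 = w i * gauge K (X (x i)) ^ 2 := by
    intro i
    rw [gauge_smul_of_nonneg (Real.sqrt_nonneg _), smul_eq_mul, mul_pow, Real.sq_sqrt (hw i)]
  have hnegG : (gaussianReal 0 1).IsNegInvariant := ⟨by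
    rw [Measure.neg]
    have := gaussianReal_map_neg (μ := 0) (v := 1)
    simpa using this⟩
  have hcot := hK.sqrt_sum_sq_mul_integral_le (gaussianReal 0 1) (fun i (g : ℝ) => g • v i)
    (fun i => by fun_prop) (fun i y => neg_smul _ _) (φ := fun y => |y|)
    (IsGaussian.integrable_id (μ := gaussianReal 0 1)).abs (fun i => gauge K (v i))
    (fun i y => by
      rw [mul_comm]
      exact map_smul_eq_mul hK.seminorm _ _)
  have hlaw : ∫ g : Fin k → ℝ, gauge K (∑ i, g i • v i) ∂(Measure.pi fun _ => gaussianReal 0 1)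
      = L * ‖t‖ * ∫ y, gauge K y ∂(stdGaussian (EuclideanSpace ℝ (Fin n))) := by
    have h1 := integral_map (μ := Measure.pi fun _ : Fin k => gaussianReal 0 1)
      (φ := fun g => ∑ i, g i • v i) (Measurable.aemeasurable (by fun_prop))
      (f := gauge K) hcont.aestronglyMeasurable
    rw [← h1, map_sum_smul_gaussian v hv, integral_map (by fun_prop) hcont.aestronglyMeasurable,
      ← integral_const_mul]
    congr 1
    ext y
    rw [gauge_smul_of_nonneg (by positivity), smul_eq_mul]
  have hmean : ∫ y, gauge K (X y) ∂ν ≤ Real.sqrt (∑ i, gauge K (v i) ^ 2) := by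
    simp only [hgv]
    rw [hsq]
    exact integral_le_sqrt_integral_sq ((memLp_two_iff_integrable_sq
      hpX.aestronglyMeasurable).2 (hint (hpX.pow 2)))
  have hCK : 0 ≤ cotypeTwoConst K := zero_le_one.trans (hK.one_le_cotypeTwoConst hn)
  rw [hlaw, ← hzdef] at hcot
  have hg := integral_gauge_stdGaussian_le hn K
  have hfinal : (∫ y, gauge K (X y) ∂ν) * z
      ≤ Real.sqrt 2 * cotypeTwoConst K * (L * ‖t‖ * (Real.sqrt n * sphereMean K)) :=
    (mul_le_mul_of_nonneg_right hmean hz.le).trans (hcot.trans (by gcongr))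
  rw [← le_div_iff₀ hz] at hfinal
  refine hfinal.trans (le_of_eq ?_)
  ring

end IsIsotropic

/-! ### Invariance under linear maps -/

section LinearImage

variable {n : ℕ} (T : EuclideanSpace ℝ (Fin n) ≃ₗ[ℝ] EuclideanSpace ℝ (Fin n))
  {K : Set (EuclideanSpace ℝ (Fin n))}

theorem gauge_image_linearEquiv (K : Set (EuclideanSpace ℝ (Fin n)))
    (x : EuclideanSpace ℝ (Fin n)) : gauge (T '' K) (T x) = gauge K x := by
  have h : ∀ y, T y ∈ T '' K ↔ y ∈ K := fun y => T.injective.mem_set_image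
  simp only [gauge_def', ← map_smul, h]

theorem IsSymmConvexBody.image_linearEquiv (hK : IsSymmConvexBody K) :
    IsSymmConvexBody (T '' K) where
  isCompact := hK.isCompact.image T.toContinuousLinearEquiv.continuous
  convex := hK.convex.linear_image T.toLinearMap
  interior_nonempty := by
    have h := T.toContinuousLinearEquiv.toHomeomorph.image_interior K
    have h2 : T '' interior K = interior (T '' K) := h
    rw [← h2]
    exact hK.interior_nonempty.image _
  neg_mem := by
    rintro _ ⟨x, hx, rfl⟩
    exact ⟨-x, hK.neg_mem x hx, map_neg T x⟩

/-- `T` is an isometry from the norm of `K` to that of `T '' K`. -/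
theorem cotypeTwoConst_image_linearEquiv (K : Set (EuclideanSpace ℝ (Fin n))) :
    cotypeTwoConst (T '' K) = cotypeTwoConst K := by
  have hset : ∀ k, cotypeTwoSet (T '' K) k = cotypeTwoSet K k := by
    intro k
    have hr : ∀ x : Fin k → EuclideanSpace ℝ (Fin n),
        rademacherSq (T '' K) (fun i => T (x i)) = rademacherSq K x := by
      intro x
      simp only [rademacherSq, ← map_smul, ← map_sum, gauge_image_linearEquiv]
    ext A
    refine and_congr_right fun _ => ⟨fun h x => ?_, fun h x => ?_⟩
    · have := h fun i => T (x i)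
      simpa only [hr, gauge_image_linearEquiv] using this
    · have hx : x = fun i => T (T.symm (x i)) := by simp
      rw [hx, hr]
      simpa only [gauge_image_linearEquiv] using h fun i => T.symm (x i)
  simp only [cotypeTwoConst, cotypeTwoConstAux, hset]

theorem abs_det_linearEquiv_pos : 0 < |LinearMap.det (T : EuclideanSpace ℝ (Fin n) →ₗ[ℝ] _)| :=
  abs_pos.2 (LinearEquiv.isUnit_det' T).ne_zero

theorem volume_real_image_linearEquiv (K : Set (EuclideanSpace ℝ (Fin n))) :
    volume.real (T '' K)
      = |LinearMap.det (T : EuclideanSpace ℝ (Fin n) →ₗ[ℝ] _)| * volume.real K := by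
  have h := Measure.addHaar_image_linearMap (volume : Measure (EuclideanSpace ℝ (Fin n)))
    (T : EuclideanSpace ℝ (Fin n) →ₗ[ℝ] _) K
  rw [Measure.real, Measure.real, ← ENNReal.toReal_ofReal (abs_nonneg (LinearMap.det _)),
    ← ENNReal.toReal_mul, ← h]
  rfl

theorem map_uniformMeasure (hK : IsConvexBody K) :
    (uniformMeasure K).map T = uniformMeasure (T '' K) := by
  have hTm : Measurable T := T.toContinuousLinearEquiv.continuous.measurable
  have hd := (LinearEquiv.isUnit_det' T).ne_zero
  have hmap := Measure.map_linearMap_addHaar_eq_smul_addHaar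
    (volume : Measure (EuclideanSpace ℝ (Fin n))) hd
  have himg := Measure.addHaar_image_linearMap (volume : Measure (EuclideanSpace ℝ (Fin n)))
    (T : EuclideanSpace ℝ (Fin n) →ₗ[ℝ] _) K
  simp only [LinearEquiv.coe_coe] at hmap himg
  have hTK : MeasurableSet (T '' K) :=
    (hK.isCompact.image T.toContinuousLinearEquiv.continuous).measurableSet
  have hr := Measure.restrict_map (μ := volume) hTm hTK
  rw [Set.preimage_image_eq K T.injective, hmap, Measure.restrict_smul] at hr
  rw [uniformMeasure, uniformMeasure, Measure.map_smul, ← hr, smul_smul, himg, abs_inv,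
    ENNReal.ofReal_inv_of_pos (abs_pos.2 hd),
    ENNReal.mul_inv (Or.inr hK.volume_ne_top) (Or.inl ENNReal.ofReal_ne_top), mul_comm]

theorem multiNorm_image_linearEquiv (hK : IsSymmConvexBody K) {s : ℕ}
    (t : EuclideanSpace ℝ (Fin s)) :
    multiNorm (fun _ : Fin s => T '' K) (T '' K) t = multiNorm (fun _ : Fin s => K) K t := by
  have hTc : Continuous T := T.toContinuousLinearEquiv.continuous
  have hTK := hK.image_linearEquiv T
  have := hK.isProbabilityMeasure
  have := hTK.isProbabilityMeasure
  rw [hK.multiNorm_eq_integral, hTK.multiNorm_eq_integral]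
  have hpi := Measure.pi_map_pi (μ := fun _ : Fin s => uniformMeasure K)
    (f := fun _ => T) (hμ := fun _ => by rw [map_uniformMeasure T hK.toIsConvexBody]; infer_instance)
    (fun _ => hTc.measurable.aemeasurable)
  simp only [map_uniformMeasure T hK.toIsConvexBody] at hpi
  have hcont : Continuous (gauge (T '' K)) := hTK.continuous_seminorm
  have hsum : Continuous fun x : Fin s → EuclideanSpace ℝ (Fin n) =>
      gauge (T '' K) (∑ j, t j • x j) := hcont.comp (by fun_prop)
  rw [← hpi, integral_map (Continuous.aemeasurable (by fun_prop)) hsum.aestronglyMeasurable]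
  simp only [← map_smul, ← map_sum, gauge_image_linearEquiv]

theorem IsConvexBody.memLp_two (hK : IsConvexBody K) {f : EuclideanSpace ℝ (Fin n) → ℝ}
    (hf : Continuous f) : MemLp f 2 (uniformMeasure K) :=
  (memLp_two_iff_integrable_sq hf.aestronglyMeasurable).2
    (hK.integrable_of_continuous (hf.pow 2))

theorem covMatrix_apply (hK : IsConvexBody K) (i j : Fin n) :
    covMatrix K i j = cov[fun x => x i, fun x => x j; uniformMeasure K] := by
  have := hK.isProbabilityMeasure
  rw [covariance_eq_sub (IsConvexBody.memLp_two hK (by fun_prop))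
    (IsConvexBody.memLp_two hK (by fun_prop))]
  simp only [IsConvexBody.integral_uniformMeasure, Pi.mul_apply, smul_eq_mul, covMatrix,
    Matrix.of_apply]
  ring

/-- Needed to split a real power of a product of determinants; the quadratic form of the covariance
matrix is a variance. -/
theorem covMatrix_det_nonneg (hK : IsConvexBody K) : 0 ≤ (covMatrix K).det := by
  have := hK.isProbabilityMeasure
  refine Matrix.PosSemidef.det_nonneg (.of_dotProduct_mulVec_nonneg ?_ fun c => ?_)
  · ext i j
    simp only [Matrix.conjTranspose_apply, star_trivial, covMatrix_apply hK]
    exact covariance_comm _ _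
  · have h : star c ⬝ᵥ (covMatrix K).mulVec c
        = cov[fun x => ∑ i, c i * x i, fun x => ∑ i, c i * x i; uniformMeasure K] := by
      rw [covariance_fun_sum_fun_sum (fun i => IsConvexBody.memLp_two hK (by fun_prop))
        (fun i => IsConvexBody.memLp_two hK (by fun_prop))]
      simp only [covariance_const_mul_left, covariance_const_mul_right, dotProduct,
        Matrix.mulVec, star_trivial, covMatrix_apply hK, Finset.mul_sum]
      exact Finset.sum_congr rfl fun i _ => Finset.sum_congr rfl fun j _ => by ring
    rw [h, covariance_self (Continuous.aemeasurable (by fun_prop))]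
    exact variance_nonneg _ _

theorem det_covMatrix_image_linearEquiv (hK : IsSymmConvexBody K) :
    (covMatrix (T '' K)).det
      = LinearMap.det (T : EuclideanSpace ℝ (Fin n) →ₗ[ℝ] _) ^ 2 * (covMatrix K).det := by
  have hK' := hK.toIsConvexBody
  have := hK.isProbabilityMeasure
  have hTc : Continuous T := T.toContinuousLinearEquiv.continuous
  let b := (EuclideanSpace.basisFun (Fin n) ℝ).toBasis
  let A := LinearMap.toMatrix b b (T : EuclideanSpace ℝ (Fin n) →ₗ[ℝ] _)
  have hA : ∀ x i, T x i = ∑ k, A i k * x k := by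
    intro x i
    have h := congrFun (LinearMap.toMatrix_mulVec_repr b b
      (T : EuclideanSpace ℝ (Fin n) →ₗ[ℝ] _) x) i
    simpa [Matrix.mulVec, dotProduct, b, A] using h.symm
  have hcov : covMatrix (T '' K) = A * covMatrix K * A.transpose := by
    ext i j
    rw [covMatrix_apply (hK.image_linearEquiv T).toIsConvexBody,
      ← map_uniformMeasure T hK', covariance_map_fun
        (Continuous.aestronglyMeasurable (by fun_prop))
        (Continuous.aestronglyMeasurable (by fun_prop)) hTc.aemeasurable]
    simp only [hA]
    rw [covariance_fun_sum_fun_sum (fun i => IsConvexBody.memLp_two hK' (by fun_prop))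
      (fun i => IsConvexBody.memLp_two hK' (by fun_prop))]
    simp only [covariance_const_mul_left, covariance_const_mul_right, Matrix.mul_apply,
      Matrix.transpose_apply, covMatrix_apply hK', Finset.sum_mul]
    rw [Finset.sum_comm]
    exact Finset.sum_congr rfl fun i _ => Finset.sum_congr rfl fun j _ => by ring
  rw [hcov, Matrix.det_mul, Matrix.det_mul, Matrix.det_transpose, LinearMap.det_toMatrix]
  ring

/-- The covariance determinant gains `det T ^ 2` and the volume `|det T|`; after the powers `1/(2n)`
and `-1/n` these cancel. -/
theorem isotropicConst_image_linearEquiv (hK : IsSymmConvexBody K) :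
    isotropicConst (T '' K) = isotropicConst K := by
  have hd := abs_det_linearEquiv_pos T
  have hv := hK.volume_real_pos
  rw [isotropicConst, isotropicConst, det_covMatrix_image_linearEquiv T hK,
    volume_real_image_linearEquiv, Real.mul_rpow (sq_nonneg _)
    (covMatrix_det_nonneg hK.toIsConvexBody), ← sq_abs]
  set d := |LinearMap.det (T : EuclideanSpace ℝ (Fin n) →ₗ[ℝ] _)| with hdd
  have h1 : (d ^ 2) ^ (1 / (2 * (n : ℝ))) = d ^ (1 / (n : ℝ)) := by
    rw [← Real.rpow_natCast d 2, ← Real.rpow_mul hd.le]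
    congr 1
    push_cast
    rw [mul_one_div, mul_comm 2 (n : ℝ), div_mul_cancel_right₀ two_ne_zero, one_div]
  have h2 : (1 / (d * volume.real K)) ^ (1 / (n : ℝ))
      = (d ^ (1 / (n : ℝ)))⁻¹ * (1 / volume.real K) ^ (1 / (n : ℝ)) := by
    rw [one_div, mul_inv, Real.mul_rpow (by positivity) (by positivity), Real.inv_rpow hd.le,
      one_div (volume.real K)]
  have h3 : d ^ (1 / (n : ℝ)) ≠ 0 := by positivity
  rw [h1, h2]
  field_simp

end LinearImage

/-! ### The two-sided estimate -/

theorem mainTheorem3 :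
    ∃ c₁ c₂ : ℝ, 0 < c₁ ∧ 0 < c₂ ∧
      (∀ (n : ℕ), 1 ≤ n → ∀ (C K : Set (EuclideanSpace ℝ (Fin n))),
        IsSymmConvexBody C → IsIsotropic C → IsSymmConvexBody K →
        ∀ (s : ℕ), 1 ≤ s → ∀ (t : EuclideanSpace ℝ (Fin s)),
          c₁ / cotypeTwoConst K * volume.real K ^ (-1 / (n : ℝ)) * ‖t‖
              ≤ multiNorm (fun _ : Fin s => C) K t ∧
          multiNorm (fun _ : Fin s => C) K t
              ≤ c₂ * isotropicConst C * cotypeTwoConst K * Real.sqrt n * sphereMean K * ‖t‖) ∧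
      (∀ (n : ℕ), 1 ≤ n → ∀ (K : Set (EuclideanSpace ℝ (Fin n))), IsSymmConvexBody K →
        ∀ (s : ℕ), 1 ≤ s → ∀ (t : EuclideanSpace ℝ (Fin s)),
          c₁ / cotypeTwoConst K * ‖t‖ ≤ multiNorm (fun _ : Fin s => K) K t ∧
          ∀ Kiso : Set (EuclideanSpace ℝ (Fin n)), IsIsotropicImage K Kiso →
            multiNorm (fun _ : Fin s => K) K t
              ≤ c₂ * isotropicConst K * cotypeTwoConst K * Real.sqrt n * sphereMean Kiso
                  * ‖t‖) := by
  refine ⟨1 / 8, Real.sqrt 2 / (∫ x, |x| ∂(gaussianReal 0 1)), by norm_num,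
    div_pos (by positivity) integral_abs_gaussianReal_pos, ?_, ?_⟩
  · intro n hn C K hCs hC hK s _ t
    refine ⟨?_, hC.multiNorm_le hK hn t⟩
    have h := IsSymmConvexBody.multiNorm_ge hCs hK hn t
    have hv : volume.real C = 1 := by simp [Measure.real, hC.volume_eq_one]
    have hw := hK.volume_real_pos
    rw [hv, one_div (volume.real K), Real.inv_rpow hw.le, ← Real.rpow_neg hw.le, ← neg_div] at h
    exact h
  · intro n hn K hK s _ t
    refine ⟨?_, ?_⟩
    · have h := IsSymmConvexBody.multiNorm_ge hK hK hn t
      rwa [div_self hK.volume_real_pos.ne', Real.one_rpow, mul_one] at h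
    · rintro _ ⟨hiso, T, rfl⟩
      -- The upper bound of (i) with both bodies equal to the isotropic image, then pulled back
      -- along `T`; only the spherical mean still depends on the position.
      have h := hiso.multiNorm_le (hK.image_linearEquiv T) hn t
      rwa [multiNorm_image_linearEquiv T hK, isotropicConst_image_linearEquiv T hK,
        cotypeTwoConst_image_linearEquiv] at h
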